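/- All graphs are finite and simple. For a positive integer $k$, a *$k$-restricted edge-cut* of a connected graph $G$ is a non-empty set $S\subseteq E(G)$ such that $G-S$ has at least two connected components and every component of $G-S$ has at least $k$ vertices; $\lambda_k(G)$ is the minimum size of a $k$-restricted edge-cut of $G$, and $G$ is *$\lambda_k$-connected* if $\lambda_k(G)$ exists, that is, if $G$ has a $k$-restricted edge-cut. The problem EREC asks, for a given connected graph $G$ and a positive integer $k$, whether $G$ is $\lambda_k$-connected. **Theorem.** EREC is fixed-parameter tractable when parameterized by $k$. More precisely, there is a single algorithm that solves EREC on all inputs $(G,k)$ in time $2^{O(k\log k)}\cdot n^2\log n$, where $n$ is the number of vertices of $G$; explicitly, there is a constant $C$ such that its running time is at most $C\cdot 2^{C k\log k}\cdot n^2\log(n+1)$ for all connected $G$ and all $k\ge 1$. Here time is the number of steps of a word RAM with words of $O(\log(n+k))$ bits and the operations $+,-,\times,\div$, which gets $n$, $k$ and the adjacency matrix of $G$ in its memory. Fixed-parameter tractable means solvable in time $f(k)\cdot n^{O(1)}$ on this machine for some computable function $f$. -/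

import Mathlib

/-! ## Restricted edge-connectivity -/

/-- `S` is an edge-cut of `G`: a nonempty set of edges such that `G - S` has at
least two connected components. -/
def IsEdgeCut {V : Type*} [Finite V] (G : SimpleGraph V) (S : Set (Sym2 V)) : Prop :=
  S.Nonempty ∧ S ⊆ G.edgeSet ∧ ¬ (G.deleteEdges S).Preconnected

/-- `S` is a `k`-restricted edge-cut of `G`: an edge-cut such that every connected component of
`G - S` has at least `k` vertices. -/
def IsRestrictedEdgeCut {V : Type*} [Finite V] (G : SimpleGraph V) (k : ℕ) (S : Set (Sym2 V)) : Prop :=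
  IsEdgeCut G S ∧ ∀ c : (G.deleteEdges S).ConnectedComponent, k ≤ c.supp.ncard

/-- `m` is the `k`-restricted edge-connectivity `λ_k(G)`: the minimum size of a `k`-restricted
edge-cut of `G`. It need not exist. -/
def IsRestrictedEdgeConnectivity {V : Type*} [Finite V] (G : SimpleGraph V) (k m : ℕ) : Prop :=
  IsLeast {l : ℕ | ∃ S : Set (Sym2 V), IsRestrictedEdgeCut G k S ∧ S.ncard = l} m

/-- A connected graph `G` is `λ_k`-connected if `λ_k(G)` exists. -/
def IsLambdaConnected {V : Type*} [Finite V] (G : SimpleGraph V) (k : ℕ) : Prop :=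
  G.Connected ∧ ∃ m : ℕ, IsRestrictedEdgeConnectivity G k m

/-! ## A word RAM

The machine has registers and a random access memory, both indexed by natural numbers and
holding natural numbers. Programs are finite and fixed in advance, and are written with
structured control flow. Each constant, register access, memory access, arithmetic operation,
test and assignment costs one step, and every number that is computed has to fit into a
machine word. -/

/-- The arithmetic operations of the machine. -/
inductive ArithOp where
  | add
  | sub
  | mul
  | div

/-- Addition, truncated subtraction, multiplication and division rounded down (with
`a / 0 = 0`). -/
def ArithOp.eval : ArithOp → ℕ → ℕ → ℕ
  | .add, a, b => a + b
  | .sub, a, b => a - b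
  | .mul, a, b => a * b
  | .div, a, b => a / b

/-- Expressions: constants, registers, memory cells at a computed address, and arithmetic. -/
inductive RamExpr where
  | const (c : ℕ)
  | reg (x : ℕ)
  | load (addr : RamExpr)
  | bin (op : ArithOp) (e₁ e₂ : RamExpr)

/-- A state of the machine: the contents of the registers and of the memory. -/
structure RamState where
  reg : ℕ → ℕ
  mem : ℕ → ℕ

/-- The value of an expression in a state. -/
def RamExpr.eval (s : RamState) : RamExpr → ℕ
  | .const c => c
  | .reg x => s.reg x
  | .load e => s.mem (e.eval s)
  | .bin op e₁ e₂ => op.eval (e₁.eval s) (e₂.eval s)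

/-- The number of steps needed to evaluate an expression: one for each of its nodes. -/
def RamExpr.cost : RamExpr → ℕ
  | .const _ => 1
  | .reg _ => 1
  | .load e => e.cost + 1
  | .bin _ e₁ e₂ => e₁.cost + e₂.cost + 1

/-- All values that occur when the expression is evaluated, in particular all addresses that
are accessed, are at most `B`. -/
def RamExpr.Fits (B : ℕ) (s : RamState) : RamExpr → Prop
  | .const c => c ≤ B
  | .reg x => s.reg x ≤ B
  | .load e => e.Fits B s ∧ s.mem (e.eval s) ≤ B
  | .bin op e₁ e₂ => e₁.Fits B s ∧ e₂.Fits B s ∧ op.eval (e₁.eval s) (e₂.eval s) ≤ B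

/-- Programs. Tests are expressions; a test succeeds if its value is not zero. -/
inductive RamProgram where
  | skip
  | assign (x : ℕ) (e : RamExpr)
  | store (addr e : RamExpr)
  | seq (p q : RamProgram)
  | cond (e : RamExpr) (p q : RamProgram)
  | loop (e : RamExpr) (p : RamProgram)

/-- `Exec B p s t s'`: the program `p`, started in the state `s`, terminates in the state `s'`
after exactly `t` steps, and no number larger than `B` is computed on the way. -/
inductive Exec (B : ℕ) : RamProgram → RamState → ℕ → RamState → Prop
  | skip (s : RamState) : Exec B .skip s 1 s
  | assign (s : RamState) (x : ℕ) (e : RamExpr) (h : e.Fits B s) :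
      Exec B (.assign x e) s (e.cost + 1) ⟨Function.update s.reg x (e.eval s), s.mem⟩
  | store (s : RamState) (a e : RamExpr) (ha : a.Fits B s) (he : e.Fits B s) :
      Exec B (.store a e) s (a.cost + e.cost + 1)
        ⟨s.reg, Function.update s.mem (a.eval s) (e.eval s)⟩
  | seq {p q : RamProgram} {s s₁ s₂ : RamState} {t₁ t₂ : ℕ}
      (h₁ : Exec B p s t₁ s₁) (h₂ : Exec B q s₁ t₂ s₂) :
      Exec B (.seq p q) s (t₁ + t₂) s₂
  | condTrue {e : RamExpr} {p q : RamProgram} {s s' : RamState} {t : ℕ} (he : e.Fits B s)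
      (hv : e.eval s ≠ 0) (h : Exec B p s t s') :
      Exec B (.cond e p q) s (e.cost + 1 + t) s'
  | condFalse {e : RamExpr} {p q : RamProgram} {s s' : RamState} {t : ℕ} (he : e.Fits B s)
      (hv : e.eval s = 0) (h : Exec B q s t s') :
      Exec B (.cond e p q) s (e.cost + 1 + t) s'
  | loopDone {e : RamExpr} {p : RamProgram} {s : RamState} (he : e.Fits B s)
      (hv : e.eval s = 0) :
      Exec B (.loop e p) s (e.cost + 1) s
  | loopStep {e : RamExpr} {p : RamProgram} {s s₁ s₂ : RamState} {t₁ t₂ : ℕ} (he : e.Fits B s)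
      (hv : e.eval s ≠ 0) (h₁ : Exec B p s t₁ s₁) (h₂ : Exec B (.loop e p) s₁ t₂ s₂) :
      Exec B (.loop e p) s (e.cost + 1 + t₁ + t₂) s₂

/-! ## Parameterized graph problems -/

open Classical in
/-- The initial state on the input `(G, k)`: all registers are zero, and the memory holds `n`
in cell `0`, `k` in cell `1`, the adjacency matrix of `G` row by row from cell `2` on, and
zeros elsewhere. -/
noncomputable def inputState {n : ℕ} (G : SimpleGraph (Fin n)) (k : ℕ) : RamState where
  reg := fun _ => 0
  mem := fun a =>
    if a = 0 then n
    else if a = 1 then k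
    else if ∃ i j : Fin n, a = 2 + (i : ℕ) * n + (j : ℕ) ∧ G.Adj i j then 1
    else 0

/-- A decision problem whose instances consist of a graph on the vertices `0, …, n - 1` and a
parameter `k`. -/
abbrev GraphProblem := ∀ n : ℕ, SimpleGraph (Fin n) → ℕ → Prop

/-- The program `P` decides the problem `Q` on all connected graphs with `n` vertices and all
positive parameters `k` within `T n k` steps, with words of `O(log (n + k))` bits. The answer
is left in register `0`. -/
def DecidesInTime (P : RamProgram) (Q : GraphProblem) (T : ℕ → ℕ → ℝ) : Prop :=
  ∃ w : ℕ, ∀ (n : ℕ) (G : SimpleGraph (Fin n)) (k : ℕ), G.Connected → 1 ≤ k →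
    ∃ (t : ℕ) (s : RamState), Exec ((n + k + 1) ^ w) P (inputState G k) t s ∧
      (t : ℝ) ≤ T n k ∧ (Q n G k → s.reg 0 = 1) ∧ (¬ Q n G k → s.reg 0 = 0)

/-- The problem `Q` is fixed-parameter tractable: some program decides it within
`f k * n ^ c` steps, for a computable function `f` and a constant `c`. -/
def IsFPT (Q : GraphProblem) : Prop :=
  ∃ (P : RamProgram) (f : ℕ → ℕ) (c : ℕ), Computable f ∧
    DecidesInTime P Q (fun n k => (f k : ℝ) * (n : ℝ) ^ c)

/-- Existential Restricted Edge-connectivity: is `G` a `λ_k`-connected graph? -/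
def EREC : GraphProblem := fun _ G k => IsLambdaConnected G k

/-! ## Executing programs -/

/-! A connected graph has a `k`-restricted edge-cut exactly when it contains two disjoint connected
sets of at least `k` vertices each (`isLambdaConnected_iff`). Two components left by a cut are such
sets. Conversely, two such sets of largest total size cover the graph, since otherwise one of them
could absorb a neighbour, and the edges between them form a restricted cut.

If `n < 2 * k`, no such pair exists. If `2 * k ≤ n < 3 * k - 2`, then `k ≥ 3` and `n ≤ k ^ 2`, so
all `n ^ (2 * k)` sequences of `2 * k` vertices can be tried. A pair of connected sets of size `k`
is encoded by listing each set so that every vertex but the first has an earlier neighbour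
(`hasDisjointConnected_iff_exists_isGrowing`).

If `n ≥ 3 * k - 2`, a search yields a spanning tree. Subtrees are merged into their parents, in
reverse order of discovery, until one has at least `k` vertices; let `c` be its root. The subtrees
below `c` have fewer than `k` vertices. The claim is that the two sets exist if and only if `G - c`
has a connected set `D` with at least `k` vertices (`MergeInv.hasDisjointConnected_iff`). One
direction holds because one of two disjoint sets avoids `c`. For the other, if the part of the tree
outside the subtree of `c` has `k` vertices, it and the subtree are the two sets. Otherwise `c`
splits the tree into connected pieces with fewer than `k` vertices, each adjacent to `c`. Collecting
pieces along `D` gives a connected set with between `k` and `2 * k - 2` vertices; its complement is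
held together by `c` and has at least `n - (2 * k - 2) ≥ k` vertices
(`hasDisjointConnected_of_pieces`). The components of `G - c` are found by further searches, in
total time `O(n ^ 2)`.

The running time is at most `1100 * k ^ (8 * k) * n ^ 2`, which is stronger than required. Machine
programs are verified by a Hoare-style calculus: weakest preconditions for loop-free code, and
invariants that carry the elapsed time for loops. -/

namespace RamExpr

instance : Add RamExpr := ⟨.bin .add⟩
instance : Sub RamExpr := ⟨.bin .sub⟩
instance : Mul RamExpr := ⟨.bin .mul⟩
instance : Div RamExpr := ⟨.bin .div⟩
instance (c : ℕ) : OfNat RamExpr c := ⟨.const c⟩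

section
variable (B : ℕ) (s : RamState) (a b : RamExpr) (c : ℕ)

@[simp] theorem eval_add : (a + b).eval s = a.eval s + b.eval s := rfl
@[simp] theorem eval_sub : (a - b).eval s = a.eval s - b.eval s := rfl
@[simp] theorem eval_mul : (a * b).eval s = a.eval s * b.eval s := rfl
@[simp] theorem eval_div : (a / b).eval s = a.eval s / b.eval s := rfl
@[simp] theorem eval_ofNat : (ofNat(c) : RamExpr).eval s = OfNat.ofNat c := rfl
@[simp] theorem eval_reg : (reg c).eval s = s.reg c := rfl
@[simp] theorem eval_load : (load a).eval s = s.mem (a.eval s) := rfl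
@[simp] theorem fits_add :
    (a + b).Fits B s ↔ a.Fits B s ∧ b.Fits B s ∧ a.eval s + b.eval s ≤ B := Iff.rfl
@[simp] theorem fits_sub :
    (a - b).Fits B s ↔ a.Fits B s ∧ b.Fits B s ∧ a.eval s - b.eval s ≤ B := Iff.rfl
@[simp] theorem fits_mul :
    (a * b).Fits B s ↔ a.Fits B s ∧ b.Fits B s ∧ a.eval s * b.eval s ≤ B := Iff.rfl
@[simp] theorem fits_div :
    (a / b).Fits B s ↔ a.Fits B s ∧ b.Fits B s ∧ a.eval s / b.eval s ≤ B := Iff.rfl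
@[simp] theorem fits_ofNat : (ofNat(c) : RamExpr).Fits B s ↔ OfNat.ofNat c ≤ B := Iff.rfl
@[simp] theorem fits_reg : (reg c).Fits B s ↔ s.reg c ≤ B := Iff.rfl
@[simp] theorem fits_load :
    (load a).Fits B s ↔ a.Fits B s ∧ s.mem (a.eval s) ≤ B := Iff.rfl
@[simp] theorem cost_add : (a + b).cost = a.cost + b.cost + 1 := rfl
@[simp] theorem cost_sub : (a - b).cost = a.cost + b.cost + 1 := rfl
@[simp] theorem cost_mul : (a * b).cost = a.cost + b.cost + 1 := rfl
@[simp] theorem cost_div : (a / b).cost = a.cost + b.cost + 1 := rfl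
@[simp] theorem cost_ofNat : (ofNat(c) : RamExpr).cost = 1 := rfl
@[simp] theorem cost_reg : (reg c).cost = 1 := rfl
@[simp] theorem cost_load : (load a).cost = a.cost + 1 := rfl
end

end RamExpr

/-- `p`, started in `s`, terminates after some number of steps `t` in some state `s'` such that
`Q t s'`, and all numbers stay at most `B`. -/
def Runs (B : ℕ) (p : RamProgram) (s : RamState) (Q : ℕ → RamState → Prop) : Prop :=
  ∃ t s', Exec B p s t s' ∧ Q t s'

theorem Runs.mono {B : ℕ} {p : RamProgram} {s : RamState} {Q R : ℕ → RamState → Prop}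
    (h : Runs B p s Q) (hQR : ∀ t s', Q t s' → R t s') : Runs B p s R := by
  obtain ⟨t, s', h, hQ⟩ := h
  exact ⟨t, s', h, hQR _ _ hQ⟩

theorem Runs.seq {B : ℕ} {p q : RamProgram} {s : RamState} {Q R : ℕ → RamState → Prop}
    (hp : Runs B p s R) (hq : ∀ t s₁, R t s₁ → Runs B q s₁ fun t' s' => Q (t + t') s') :
    Runs B (.seq p q) s Q := by
  obtain ⟨t, s₁, h, hR⟩ := hp
  obtain ⟨t', s', h', hQ⟩ := hq _ _ hR
  exact ⟨_, _, .seq h h', hQ⟩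

theorem Runs.cond {B : ℕ} {e : RamExpr} {p q : RamProgram} {s : RamState}
    {Q : ℕ → RamState → Prop} (he : e.Fits B s)
    (hp : e.eval s ≠ 0 → Runs B p s fun t s' => Q (e.cost + 1 + t) s')
    (hq : e.eval s = 0 → Runs B q s fun t s' => Q (e.cost + 1 + t) s') :
    Runs B (.cond e p q) s Q := by
  by_cases h : e.eval s = 0
  · obtain ⟨t, s', hx, hQ⟩ := hq h
    exact ⟨_, _, .condFalse he h hx, hQ⟩
  · obtain ⟨t, s', hx, hQ⟩ := hp h
    exact ⟨_, _, .condTrue he h hx, hQ⟩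

/-- The rule for loops: `I t s` is an invariant that may mention the number `t` of steps made
so far, and `μ` decreases with every pass. -/
theorem Runs.loop {B : ℕ} {e : RamExpr} {p : RamProgram} {s : RamState}
    {Q : ℕ → RamState → Prop} (I : ℕ → RamState → Prop) (μ : RamState → ℕ)
    (hfits : ∀ t s, I t s → e.Fits B s)
    (hdone : ∀ t s, I t s → e.eval s = 0 → Q (t + (e.cost + 1)) s)
    (hstep : ∀ t s, I t s → e.eval s ≠ 0 →
      Runs B p s fun t' s' => I (t + (e.cost + 1 + t')) s' ∧ μ s' < μ s)
    (h0 : I 0 s) : Runs B (.loop e p) s Q := by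
  -- The elapsed time is generalized as well, so that the induction hypothesis applies after a pass
  -- that has used up some steps.
  have key : ∀ m t s, μ s = m → I t s → Runs B (.loop e p) s fun t' s' => Q (t + t') s' := by
    intro m
    induction m using Nat.strong_induction_on with
    | _ m ih =>
      intro t s hm hI
      by_cases h : e.eval s = 0
      · exact ⟨_, _, .loopDone (hfits _ _ hI) h, hdone _ _ hI h⟩
      · obtain ⟨t₁, s₁, hx, hI₁, hlt⟩ := hstep _ _ hI h
        obtain ⟨t₂, s₂, hx₂, hQ⟩ := ih _ (hm ▸ hlt) _ _ rfl hI₁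
        refine ⟨_, _, .loopStep (hfits _ _ hI) h hx hx₂, ?_⟩
        simpa only [add_assoc] using hQ
  simpa using key _ 0 s rfl h0

namespace RamProgram

/-- An upper bound for the number of steps of a loop-free program. -/
def maxCost : RamProgram → ℕ
  | skip => 1
  | assign _ e => e.cost + 1
  | store a e => a.cost + e.cost + 1
  | seq p q => p.maxCost + q.maxCost
  | cond e p q => e.cost + 1 + max p.maxCost q.maxCost
  -- A junk value: `Wp` is false on loops, so the bound is never used for them.
  | loop _ _ => 0

/-- The weakest precondition of a loop-free program. -/
def Wp (B : ℕ) : RamProgram → (RamState → Prop) → RamState → Prop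
  | skip, Q, s => Q s
  | assign x e, Q, s => e.Fits B s ∧ Q ⟨Function.update s.reg x (e.eval s), s.mem⟩
  | store a e, Q, s => a.Fits B s ∧ e.Fits B s ∧
      Q ⟨s.reg, Function.update s.mem (a.eval s) (e.eval s)⟩
  | seq p q, Q, s => p.Wp B (q.Wp B Q) s
  | cond e p q, Q, s => e.Fits B s ∧ (e.eval s ≠ 0 → p.Wp B Q s) ∧ (e.eval s = 0 → q.Wp B Q s)
  | loop _ _, _, _ => False

theorem Wp.runs {B : ℕ} {p : RamProgram} {Q : RamState → Prop} {s : RamState}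
    (h : p.Wp B Q s) : Runs B p s fun t s' => t ≤ p.maxCost ∧ Q s' := by
  induction p generalizing Q s with
  | skip => exact ⟨_, _, .skip s, le_rfl, h⟩
  | assign x e => exact ⟨_, _, .assign s x e h.1, le_rfl, h.2⟩
  | store a e => exact ⟨_, _, .store s a e h.1 h.2.1, le_rfl, h.2.2⟩
  | seq p q hp hq =>
    refine Runs.seq (hp h) fun t s₁ h₁ => (hq h₁.2).mono fun t' s' h' => ⟨?_, h'.2⟩
    have := h₁.1
    have := h'.1
    simp only [maxCost]
    omega
  | cond e p q hp hq =>
    refine Runs.cond h.1 (fun h₀ => (hp (h.2.1 h₀)).mono fun t s' h' => ⟨?_, h'.2⟩)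
      (fun h₀ => (hq (h.2.2 h₀)).mono fun t s' h' => ⟨?_, h'.2⟩) <;>
    · have := h'.1
      simp only [maxCost]
      omega
  | loop e p => exact h.elim

end RamProgram

/-- Quantifying over all `t ≤ p.maxCost` spares any tracking of the exact number of steps through
the branches of `p`. -/
theorem Runs.of_wp {B : ℕ} {p : RamProgram} {Q : ℕ → RamState → Prop} {s : RamState}
    (h : p.Wp B (fun s' => ∀ t ≤ p.maxCost, Q t s') s) : Runs B p s Q :=
  h.runs.mono fun t _ h' => h'.2 t h'.1

-- Memory layout and the data of a breadth-first search

infixr:60 " ;; " => RamProgram.seq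

/-- The `j`-th of the four arrays that are interleaved in the memory from address `b` on. -/
def cell (b j : ℕ) (m : ℕ → ℕ) : ℕ → ℕ := fun i => m (b + 4 * i + j)

theorem cell_update_self (b j i x : ℕ) (m : ℕ → ℕ) :
    cell b j (Function.update m (b + 4 * i + j) x) = Function.update (cell b j m) i x := by
  funext a
  simp only [cell, Function.update_apply]
  congr 1
  simp

/-- Entries of different arrays have addresses in different residue classes modulo 4 relative to
`b`. -/
theorem cell_update_of_ne {b j j' : ℕ} (i x : ℕ) (m : ℕ → ℕ) (hj : j < 4) (hj' : j' < 4)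
    (h : j ≠ j') : cell b j (Function.update m (b + 4 * i + j') x) = cell b j m := by
  funext a
  simp only [cell, Function.update_apply]
  rw [if_neg (by omega)]

@[simp] theorem cell_zero_update (b i x : ℕ) (m : ℕ → ℕ) :
    cell b 0 (Function.update m (b + 4 * i) x) = Function.update (cell b 0 m) i x :=
  cell_update_self b 0 i x m

theorem cell_update_zero {b j : ℕ} (i x : ℕ) (m : ℕ → ℕ) (hj : j < 4) (h : j ≠ 0) :
    cell b j (Function.update m (b + 4 * i) x) = cell b j m :=
  cell_update_of_ne i x m hj (by norm_num) h

/-- The expression for the address of entry `e` of the `j`-th array. -/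
def cellAddr (j : ℕ) (e : RamExpr) : RamExpr := .reg 3 + 4 * e + .const j

@[simp] theorem eval_cellAddr (j : ℕ) (e : RamExpr) (s : RamState) :
    (cellAddr j e).eval s = s.reg 3 + 4 * e.eval s + j := rfl

/-- All intermediate values except the constant `4` are bounded by the final address. -/
theorem fits_cellAddr {B j : ℕ} {e : RamExpr} {s : RamState} (hB : 4 ≤ B) :
    (cellAddr j e).Fits B s ↔ e.Fits B s ∧ s.reg 3 + 4 * e.eval s + j ≤ B := by
  change ((_ ∧ (_ ∧ e.Fits B s ∧ 4 * e.eval s ≤ B) ∧ s.reg 3 + 4 * e.eval s ≤ B) ∧ j ≤ B ∧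
    s.reg 3 + 4 * e.eval s + j ≤ B) ↔ _
  constructor
  · rintro ⟨⟨-, ⟨-, h, -⟩, -⟩, -, h'⟩
    exact ⟨h, h'⟩
  · rintro ⟨h, h'⟩
    refine ⟨⟨?_, ⟨hB, h, by omega⟩, by omega⟩, by omega, h'⟩
    change s.reg 3 ≤ B
    omega

@[simp] theorem cost_cellAddr (j : ℕ) (e : RamExpr) : (cellAddr j e).cost = e.cost + 6 := by
  change 1 + (1 + e.cost + 1) + 1 + 1 + 1 = _
  omega

/-- The expression that reads the entry of the adjacency matrix at `(e, e')`. -/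
def adjEntry (e e' : RamExpr) : RamExpr := .load (2 + e * .reg 1 + e')

/-- The data of a graph search that starts at `s` and does not enter `X`, at the moment when
the first `h` of the `t` discovered vertices `q 0, …, q (t - 1)` have been processed;
`q (p i)` is the vertex from which `q i` was discovered. -/
structure SearchInv (n : ℕ) (E : ℕ → ℕ → Prop) (X : ℕ → Prop) (s : ℕ) (vis q p : ℕ → ℕ)
    (h t : ℕ) : Prop where
  head_le : h ≤ t
  pos : 0 < t
  first : q 0 = s
  lt : ∀ i < t, q i < n
  inj : ∀ i < t, ∀ j < i, q j ≠ q i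
  notMem : ∀ i < t, ¬ X (q i)
  vis_le : ∀ v < n, vis v ≤ 1
  vis_iff : ∀ v < n, vis v ≠ 0 ↔ X v ∨ ∃ i < t, q i = v
  parent : ∀ i < t, 0 < i → p i < i ∧ E (q (p i)) (q i)
  closed : ∀ i < h, ∀ w < n, E (q i) w → vis w ≠ 0

namespace SearchInv

variable {n : ℕ} {E : ℕ → ℕ → Prop} {X : ℕ → Prop} {s : ℕ} {vis q p : ℕ → ℕ} {h t : ℕ}

theorem card_image (H : SearchInv n E X s vis q p h t) :
    ((Finset.range t).image q).card = t := by
  rw [Finset.card_image_of_injOn, Finset.card_range]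
  intro i hi j hj hij
  simp only [Finset.coe_range, Set.mem_Iio] at hi hj
  rcases lt_trichotomy i j with hlt | hlt | hlt
  · exact (H.inj j hj i hlt hij).elim
  · exact hlt
  · exact (H.inj i hi j hlt hij.symm).elim

/-- The queue holds distinct vertices. This bounds both the length of the search and the addresses
it uses. -/
theorem le_n (H : SearchInv n E X s vis q p h t) : t ≤ n := by
  have := Finset.card_le_card (s := (Finset.range t).image q) (t := Finset.range n) (by
    intro v hv
    simp only [Finset.mem_image, Finset.mem_range] at hv ⊢
    obtain ⟨i, hi, rfl⟩ := hv
    exact H.lt i hi)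
  rwa [H.card_image, Finset.card_range] at this

theorem init {vis : ℕ → ℕ} (q p : ℕ → ℕ) (hs : s < n) (hvis : ∀ v < n, vis v ≤ 1)
    (h0 : vis s = 0) :
    SearchInv n E (fun v => vis v ≠ 0) s (Function.update vis s 1) (Function.update q 0 s) p
      0 1 where
  head_le := by simp
  pos := by simp
  first := by simp
  lt i hi := by
    obtain rfl : i = 0 := by omega
    simpa using hs
  inj i hi j hj := by omega
  notMem i hi := by
    obtain rfl : i = 0 := by omega
    simpa using h0
  vis_le v hv := by
    rw [Function.update_apply]
    split
    · exact le_rfl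
    · exact hvis v hv
  vis_iff v hv := by
    by_cases h : v = s
    · subst h
      simp
    · simp [h, Ne.symm h]
  parent i hi := by omega
  closed i hi := by omega

theorem visit (H : SearchInv n E X s vis q p h t) {v : ℕ} (hv : v < n) (hht : h < t)
    (hE : E (q h) v) (h0 : vis v = 0) :
    SearchInv n E X s (Function.update vis v 1) (Function.update q t v) (Function.update p t h)
      h (t + 1) := by
  have hnot := (H.vis_iff v hv).not.1 (by simpa using h0)
  push Not at hnot
  have hq : ∀ i < t, Function.update q t v i = q i := fun i hi => by
    rw [Function.update_of_ne (by omega)]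
  have hp : ∀ i < t, Function.update p t h i = p i := fun i hi => by
    rw [Function.update_of_ne (by omega)]
  have hcases : ∀ i < t + 1, i < t ∨ i = t := fun i hi => by omega
  refine ⟨by omega, by omega, ?_, ?_, ?_, ?_, ?_, ?_, ?_, ?_⟩
  · rw [hq 0 H.pos, H.first]
  · intro i hi
    rcases hcases i hi with hi | rfl
    · rw [hq i hi]
      exact H.lt i hi
    · simpa using hv
  · intro i hi j hj
    rcases hcases i hi with hi | rfl
    · rw [hq i hi, hq j (by omega)]
      exact H.inj i hi j hj
    · rw [hq j hj, Function.update_self]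
      exact hnot.2 j hj
  · intro i hi
    rcases hcases i hi with hi | rfl
    · rw [hq i hi]
      exact H.notMem i hi
    · simpa using hnot.1
  · intro w hw
    rw [Function.update_apply]
    split
    · exact le_rfl
    · exact H.vis_le w hw
  · intro w hw
    by_cases hwv : w = v
    · subst hwv
      simp only [Function.update_self, ne_eq, one_ne_zero, not_false_eq_true, true_iff]
      exact .inr ⟨t, by omega, by simp⟩
    · rw [Function.update_of_ne hwv, H.vis_iff w hw]
      refine or_congr_right ⟨?_, ?_⟩
      · rintro ⟨i, hi, rfl⟩
        exact ⟨i, by omega, hq i hi⟩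
      · rintro ⟨i, hi, hiw⟩
        rcases hcases i hi with hi | rfl
        · exact ⟨i, hi, by rw [← hiw, hq i hi]⟩
        · rw [Function.update_self] at hiw
          exact (hwv hiw.symm).elim
  · intro i hi hi0
    rcases hcases i hi with hi | rfl
    · have := H.parent i hi hi0
      rw [hp i hi, hq i hi, hq _ (by omega)]
      exact this
    · rw [Function.update_self, Function.update_self, hq h hht]
      exact ⟨hht, hE⟩
  · intro i hi w hw hEw
    rw [hq i (by omega)] at hEw
    rw [Function.update_apply]
    split
    · simp
    · exact H.closed i hi w hw hEw

theorem advance (H : SearchInv n E X s vis q p h t) (hht : h < t)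
    (hc : ∀ w < n, E (q h) w → vis w ≠ 0) : SearchInv n E X s vis q p (h + 1) t :=
  { H with
    head_le := hht
    closed := fun i hi => by
      rcases Nat.lt_succ_iff_lt_or_eq.1 hi with hi | rfl
      · exact H.closed i hi
      · exact hc }

end SearchInv

/-- The number of vertices, the parameter and the adjacency matrix, given as the memory `m₀`
of the machine, together with the assumption that small numbers fit into a word. -/
structure IsInput (B n k : ℕ) (m₀ : ℕ → ℕ) : Prop where
  pos : 0 < n
  param_pos : 0 < k
  bound : n * n + 16 * n + 16 * k + 100 ≤ B
  adj_le : ∀ u < n, ∀ v < n, m₀ (2 + u * n + v) ≤ 1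

/-- Adjacency of vertices, read off from the memory. -/
def MemAdj (n : ℕ) (m₀ : ℕ → ℕ) (u v : ℕ) : Prop := m₀ (2 + u * n + v) ≠ 0

/-- The part of the state that is not changed by a graph search. -/
structure Frame (n k : ℕ) (m₀ : ℕ → ℕ) (r₀ r₈ r₉ : ℕ) (z : ℕ → ℕ) (s : RamState) : Prop where
  r₀ : s.reg 0 = r₀
  r₁ : s.reg 1 = n
  r₂ : s.reg 2 = k
  r₃ : s.reg 3 = 2 + n * n
  r₈ : s.reg 8 = r₈
  r₉ : s.reg 9 = r₉
  low : ∀ a < 2 + n * n, s.mem a = m₀ a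
  z : cell (2 + n * n) 3 s.mem = z

theorem Frame.assign {n k : ℕ} {m₀ : ℕ → ℕ} {r₀ r₈ r₉ : ℕ} {z : ℕ → ℕ} {s : RamState}
    (H : Frame n k m₀ r₀ r₈ r₉ z s) {x : ℕ} (v : ℕ) (hx : 3 < x) (hx' : x < 8) :
    Frame n k m₀ r₀ r₈ r₉ z ⟨Function.update s.reg x v, s.mem⟩ := by
  obtain ⟨h0, h1, h2, h3, h8, h9, hl, hz⟩ := H
  constructor <;> first | assumption | (dsimp only; rwa [Function.update_of_ne (by omega)])

theorem Frame.store {n k : ℕ} {m₀ : ℕ → ℕ} {r₀ r₈ r₉ : ℕ} {z : ℕ → ℕ} {s : RamState}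
    (H : Frame n k m₀ r₀ r₈ r₉ z s) (i v : ℕ) {j : ℕ} (hj : j < 3) :
    Frame n k m₀ r₀ r₈ r₉ z ⟨s.reg, Function.update s.mem (2 + n * n + 4 * i + j) v⟩ := by
  obtain ⟨h0, h1, h2, h3, h8, h9, hl, hz⟩ := H
  refine ⟨h0, h1, h2, h3, h8, h9, fun a ha => ?_, ?_⟩
  · dsimp only
    rw [Function.update_of_ne (by omega), hl a ha]
  · dsimp only
    rw [cell_update_of_ne _ _ _ (by omega) (by omega) (by omega), hz]

theorem adj_addr_lt {n u v : ℕ} (hu : u < n) (hv : v < n) : u * n + v < n * n := by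
  have : (u + 1) * n ≤ n * n := Nat.mul_le_mul_right _ hu
  rw [add_mul] at this
  omega

/-- The invariant of the graph search in terms of states. -/
structure SearchState (n k : ℕ) (m₀ : ℕ → ℕ) (r₀ r₈ r₉ : ℕ) (z : ℕ → ℕ) (X : ℕ → Prop)
    (s : RamState) : Prop where
  frame : Frame n k m₀ r₀ r₈ r₉ z s
  inv : SearchInv n (MemAdj n m₀) X r₉ (cell (2 + n * n) 0 s.mem) (cell (2 + n * n) 1 s.mem)
    (cell (2 + n * n) 2 s.mem) (s.reg 4) (s.reg 5)

/-! ### The search program -/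

section
open RamExpr RamProgram

/-- Visit the vertex in register `7` from the vertex in register `6`. -/
def visitProgram : RamProgram :=
  .cond (adjEntry (reg 6) (reg 7) * (1 - load (cellAddr 0 (reg 7))))
    (store (cellAddr 0 (reg 7)) 1 ;; store (cellAddr 1 (reg 5)) (reg 7) ;;
      store (cellAddr 2 (reg 5)) (reg 4) ;; assign 5 (reg 5 + 1)) skip ;;
  assign 7 (reg 7 + 1)

/-- Process the next vertex of the queue. -/
def scanProgram : RamProgram :=
  assign 6 (load (cellAddr 1 (reg 4))) ;; assign 7 0 ;; loop (reg 1 - reg 7) visitProgram ;;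
  assign 4 (reg 4 + 1)

/-- Search the graph from the vertex in register `9`. -/
def searchProgram : RamProgram :=
  store (cellAddr 0 (reg 9)) 1 ;; store (cellAddr 1 0) (reg 9) ;; assign 4 0 ;; assign 5 1 ;;
  loop (reg 5 - reg 4) scanProgram

variable {B n k : ℕ} {m₀ : ℕ → ℕ} {r₀ r₈ r₉ : ℕ} {z : ℕ → ℕ} {X : ℕ → Prop}

theorem fits_adjEntry (hI : IsInput B n k m₀) {e e' : RamExpr} {s : RamState}
    (h1 : s.reg 1 = n) (hlow : ∀ a < 2 + n * n, s.mem a = m₀ a) (he : e.Fits B s)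
    (he' : e'.Fits B s) (hu : e.eval s < n) (hv : e'.eval s < n) :
    (adjEntry e e').Fits B s ∧
      (adjEntry e e').eval s = m₀ (2 + e.eval s * n + e'.eval s) := by
  have h := adj_addr_lt hu hv
  have hB := hI.bound
  have hm := hI.adj_le _ hu _ hv
  have hval : (adjEntry e e').eval s = m₀ (2 + e.eval s * n + e'.eval s) := by
    simp only [adjEntry, eval_load, eval_add, eval_mul, eval_reg, eval_ofNat, h1]
    exact hlow _ (by omega)
  refine ⟨?_, hval⟩
  have hval' : s.mem (2 + e.eval s * n + e'.eval s) = m₀ (2 + e.eval s * n + e'.eval s) :=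
    hlow _ (by omega)
  simp only [adjEntry, fits_load, fits_add, fits_mul, fits_ofNat, fits_reg, eval_add, eval_mul,
    eval_reg, eval_ofNat, h1, hval']
  refine ⟨⟨⟨by omega, ⟨he, by omega, by omega⟩, by omega⟩, he', by omega⟩, by omega⟩

theorem visit_runs (hI : IsInput B n k m₀) {s : RamState}
    (H : SearchState n k m₀ r₀ r₈ r₉ z X s) (hht : s.reg 4 < s.reg 5) (hv : s.reg 7 < n)
    (h6 : s.reg 6 = cell (2 + n * n) 1 s.mem (s.reg 4)) :
    Runs B visitProgram s fun t s' => t ≤ 60 ∧ SearchState n k m₀ r₀ r₈ r₉ z X s' ∧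
      s'.reg 4 = s.reg 4 ∧ s'.reg 4 < s'.reg 5 ∧ s'.reg 6 = s.reg 6 ∧
      s'.reg 6 = cell (2 + n * n) 1 s'.mem (s'.reg 4) ∧ s'.reg 7 = s.reg 7 + 1 ∧
      (∀ w, cell (2 + n * n) 0 s.mem w ≠ 0 → cell (2 + n * n) 0 s'.mem w ≠ 0) ∧
      (MemAdj n m₀ (s.reg 6) (s.reg 7) → cell (2 + n * n) 0 s'.mem (s.reg 7) ≠ 0) := by
  have hB := hI.bound
  have htn := H.inv.le_n
  have h3 := H.frame.r₃
  have hu : s.reg 6 < n := h6 ▸ H.inv.lt _ hht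
  have hvis := H.inv.vis_le _ hv
  obtain ⟨hf, hval⟩ := fits_adjEntry hI (e := reg 6) (e' := reg 7) H.frame.r₁ H.frame.low
    (by simp only [fits_reg]; omega) (by simp only [fits_reg]; omega) hu hv
  simp only [eval_reg] at hval
  have hadj := hI.adj_le _ hu _ hv
  have hmem : s.mem (2 + n * n + 4 * s.reg 7 + 0) = cell (2 + n * n) 0 s.mem (s.reg 7) := rfl
  -- The product of two values in `{0, 1}` serves as the conjunction "adjacent and not yet visited".
  have hmul : m₀ (2 + s.reg 6 * n + s.reg 7) * (1 - cell (2 + n * n) 0 s.mem (s.reg 7)) ≤ 1 :=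
    Nat.mul_le_mul hadj (Nat.sub_le _ _)
  have hcost : visitProgram.maxCost ≤ 60 := by
    simp [visitProgram, maxCost, adjEntry]
  refine Runs.of_wp ⟨?_, fun hne => ?_, fun h0 => ?_⟩
  · simp only [fits_mul, fits_sub, fits_ofNat, fits_load, fits_cellAddr (show 4 ≤ B by omega),
      fits_reg, eval_sub, eval_load, eval_cellAddr, eval_reg, eval_ofNat, hval, h3, hmem]
    refine ⟨hf, ⟨by omega, ⟨⟨by omega, by omega⟩, by omega⟩, by omega⟩, by omega⟩
  · simp only [eval_mul, eval_sub, eval_load, eval_cellAddr, eval_reg, eval_ofNat, hval, h3,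
      hmem] at hne
    have hE : MemAdj n m₀ (s.reg 6) (s.reg 7) := left_ne_zero_of_mul hne
    have h0 : cell (2 + n * n) 0 s.mem (s.reg 7) = 0 := by
      have := right_ne_zero_of_mul hne
      omega
    simp only [Wp, fits_ofNat, fits_cellAddr (show 4 ≤ B by omega), fits_reg, fits_add, eval_add,
      eval_cellAddr, eval_reg, eval_ofNat, h3]
    refine ⟨⟨by omega, by omega⟩, by omega, ⟨by omega, by omega⟩, by omega,
      ⟨by omega, by omega⟩, by omega, ⟨by omega, by omega, by omega⟩, ?_⟩
    simp only [Function.update_self, ne_eq, not_false_eq_true,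
      Function.update_of_ne, Nat.reduceEqDiff]
    refine ⟨⟨by omega, by omega, by omega⟩, fun t ht => ⟨ht.trans hcost, ⟨?_, ?_⟩, ?_⟩⟩
    · exact ((((H.frame.store _ _ (by norm_num)).store _ _ (by norm_num)).store _ _
        (by norm_num)).assign _ (by norm_num) (by norm_num)).assign _ (by norm_num) (by norm_num)
    · have := H.inv.visit hv hht (h6 ▸ hE) h0
      simpa [cell_update_self, cell_update_of_ne, cell_update_zero] using this
    · simp [cell_update_self, cell_update_of_ne, cell_update_zero, h6]
      refine ⟨by omega, ?_, ?_⟩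
      · rw [Function.update_of_ne (by omega)]
      · intro w hw
        rw [Function.update_apply]
        split
        · exact one_ne_zero
        · exact hw
  · simp only [eval_mul, eval_sub, eval_load, eval_cellAddr, eval_reg, eval_ofNat, hval, h3,
      hmem] at h0
    simp only [Wp, fits_ofNat, fits_reg, fits_add, eval_add, eval_reg, eval_ofNat]
    refine ⟨⟨by omega, by omega, by omega⟩, fun t ht => ⟨ht.trans hcost, ⟨?_, ?_⟩, ?_⟩⟩
    · exact H.frame.assign _ (by norm_num) (by norm_num)
    · simpa using H.inv
    · simp only [Function.update_self, ne_eq, not_false_eq_true,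
        Function.update_of_ne, Nat.reduceEqDiff]
      refine ⟨trivial, hht, trivial, h6, trivial, fun _ h => h, fun hE => ?_⟩
      rcases mul_eq_zero.1 h0 with h | h
      · exact (hE h).elim
      · omega
end

section
open RamExpr RamProgram

variable {B n k : ℕ} {m₀ : ℕ → ℕ} {r₀ r₈ r₉ : ℕ} {z : ℕ → ℕ} {X : ℕ → Prop}

theorem scan_runs (hI : IsInput B n k m₀) {s : RamState}
    (H : SearchState n k m₀ r₀ r₈ r₉ z X s) (hht : s.reg 4 < s.reg 5) :
    Runs B scanProgram s fun t s' => t ≤ 84 * n ∧ SearchState n k m₀ r₀ r₈ r₉ z X s' ∧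
      s'.reg 4 = s.reg 4 + 1 := by
  have hB := hI.bound
  have hn := hI.pos
  have htn := H.inv.le_n
  have hq := H.inv.lt _ hht
  have hmem : s.mem (2 + n * n + 4 * s.reg 4 + 1) = cell (2 + n * n) 1 s.mem (s.reg 4) := rfl
  -- Each pass costs at most 60 steps for `visitProgram` and 4 for the loop test.
  let I : ℕ → RamState → Prop := fun t s' => t ≤ 64 * s'.reg 7 ∧ s'.reg 7 ≤ n ∧
    SearchState n k m₀ r₀ r₈ r₉ z X s' ∧ s'.reg 4 = s.reg 4 ∧ s'.reg 4 < s'.reg 5 ∧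
    s'.reg 6 = cell (2 + n * n) 1 s'.mem (s'.reg 4) ∧
    ∀ w < s'.reg 7, MemAdj n m₀ (s'.reg 6) w → cell (2 + n * n) 0 s'.mem w ≠ 0
  refine Runs.seq (R := fun t s' => t ≤ 9 ∧ SearchState n k m₀ r₀ r₈ r₉ z X s' ∧
    s'.reg 4 = s.reg 4 ∧ s'.reg 4 < s'.reg 5 ∧
    s'.reg 6 = cell (2 + n * n) 1 s'.mem (s'.reg 4)) (Runs.of_wp ?_) fun t s₁ h₁ => ?_
  · simp only [Wp, fits_load, fits_cellAddr (show 4 ≤ B by omega), fits_reg, eval_load,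
      eval_cellAddr, eval_reg, H.frame.r₃, hmem]
    refine ⟨⟨⟨by omega, by omega⟩, by omega⟩, fun t ht => ⟨?_, ⟨?_, ?_⟩, ?_⟩⟩
    · simpa [maxCost] using ht
    · exact H.frame.assign _ (by norm_num) (by norm_num)
    · simpa using H.inv
    · simpa using hht
  obtain ⟨ht₁, H₁, h4, h45, h6⟩ := h₁
  refine Runs.seq (R := fun t s' => t ≤ 2 ∧ I 0 s') (Runs.of_wp ?_) fun t₂ s₂ h₂ => ?_
  · simp only [Wp, fits_ofNat, eval_ofNat]
    refine ⟨by omega, fun t ht => ⟨?_, by simp, by simp, ⟨?_, ?_⟩, ?_⟩⟩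
    · simpa [maxCost] using ht
    · exact H₁.frame.assign _ (by norm_num) (by norm_num)
    · simpa using H₁.inv
    · simp [h4, h6]
      omega
  refine Runs.seq (R := fun t s' => t ≤ 64 * n + 4 ∧ SearchState n k m₀ r₀ r₈ r₉ z X s' ∧
    s'.reg 4 = s.reg 4 ∧ s'.reg 4 < s'.reg 5 ∧
    ∀ w < n, MemAdj n m₀ (cell (2 + n * n) 1 s'.mem (s'.reg 4)) w →
      cell (2 + n * n) 0 s'.mem w ≠ 0)
    (Runs.loop I (fun s' => n - s'.reg 7) ?_ ?_ ?_ h₂.2) fun t₃ s₃ h₃ => ?_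
  · rintro t s' ⟨-, h7, H', -⟩
    simp only [fits_sub, fits_reg, eval_reg, H'.frame.r₁]
    omega
  · rintro t s' ⟨ht, h7, H', h4', h45', h6', hw⟩ h0
    simp only [eval_sub, eval_reg, H'.frame.r₁] at h0
    refine ⟨?_, H', h4', h45', fun w hwn => ?_⟩
    · simp only [cost_sub, cost_reg]
      omega
    · rw [← h6']
      exact hw w (by omega)
  · rintro t s' ⟨ht, h7, H', h4', h45', h6', hw⟩ h0
    simp only [eval_sub, eval_reg, H'.frame.r₁] at h0
    refine (visit_runs hI H' h45' (by omega) h6').mono ?_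
    rintro t' s'' ⟨ht', H'', h4'', h45'', h6a, h6'', h7'', hkeep, hnew⟩
    refine ⟨⟨?_, by omega, H'', by omega, h45'', h6'', fun w hlt hE => ?_⟩, by omega⟩
    · simp only [cost_sub, cost_reg]
      omega
    · rw [h6a] at hE
      rcases Nat.lt_succ_iff_lt_or_eq.1 (h7'' ▸ hlt) with hlt | rfl
      · exact hkeep w (hw w hlt hE)
      · exact hnew hE
  obtain ⟨ht₃, H₃, h4₃, h45₃, hcl⟩ := h₃
  have := H₃.inv.le_n
  refine Runs.of_wp ?_
  simp only [Wp, fits_add, fits_ofNat, fits_reg, eval_add, eval_ofNat, eval_reg]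
  refine ⟨⟨by omega, by omega, by omega⟩, fun t' ht' => ⟨?_, ⟨?_, ?_⟩, by simp [h4₃]⟩⟩
  · simp [maxCost] at ht'
    have := h₂.1
    omega
  · exact H₃.frame.assign _ (by norm_num) (by norm_num)
  · simpa using H₃.inv.advance h45₃ hcl

/-- The time is measured by the number `s'.reg 5` of vertices found rather than by `n`. This lets a
sequence of searches over disjoint sets of vertices run in time `O(n ^ 2)` altogether. -/
theorem search_runs (hI : IsInput B n k m₀) {s : RamState} (H : Frame n k m₀ r₀ r₈ r₉ z s)
    (hvis : ∀ v < n, cell (2 + n * n) 0 s.mem v ≤ 1) (hr : r₉ < n)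
    (h0 : cell (2 + n * n) 0 s.mem r₉ = 0) :
    Runs B searchProgram s fun t s' => t ≤ 88 * n * s'.reg 5 + 40 ∧
      SearchState n k m₀ r₀ r₈ r₉ z (fun v => cell (2 + n * n) 0 s.mem v ≠ 0) s' ∧
      s'.reg 4 = s'.reg 5 := by
  have hB := hI.bound
  have hn := hI.pos
  let I : ℕ → RamState → Prop := fun t s' => t ≤ (84 * n + 4) * s'.reg 4 ∧
      SearchState n k m₀ r₀ r₈ r₉ z (fun v => cell (2 + n * n) 0 s.mem v ≠ 0) s'
  have hpre : Runs B (store (cellAddr 0 (reg 9)) 1 ;; store (cellAddr 1 0) (reg 9) ;;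
      assign 4 0 ;; assign 5 1) s fun t s' => t ≤ 30 ∧ I 0 s' := by
    refine Runs.of_wp ?_
    simp only [Wp, fits_ofNat, fits_cellAddr (show 4 ≤ B by omega), fits_reg,
      eval_cellAddr, eval_reg, eval_ofNat, H.r₃, H.r₉]
    refine ⟨⟨by omega, by omega⟩, by omega, ⟨by omega, by omega⟩, by omega, by omega, by omega,
      fun t ht => ⟨?_, by simp, ?_, ?_⟩⟩
    · simp [maxCost] at ht
      omega
    · exact (((H.store _ _ (by norm_num)).store _ _ (by norm_num)).assign _ (by norm_num)
        (by norm_num)).assign _ (by norm_num) (by norm_num)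
    · have := SearchInv.init (E := MemAdj n m₀) (cell (2 + n * n) 1 s.mem)
        (cell (2 + n * n) 2 s.mem) hr hvis h0
      have e := cell_update_self (2 + n * n) 1 0 r₉
      have e0 := cell_update_of_ne (b := 2 + n * n) (j := 0) (j' := 1) 0 r₉
      have e2 := cell_update_of_ne (b := 2 + n * n) (j := 2) (j' := 1) 0 r₉
      simp only [mul_zero, add_zero] at e e0 e2
      simpa [e, e0, e2, cell_update_zero] using this
  have hloop : ∀ s₁, I 0 s₁ → Runs B (loop (reg 5 - reg 4) scanProgram) s₁ fun t s' =>
      t ≤ (84 * n + 4) * s'.reg 5 + 4 ∧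
      SearchState n k m₀ r₀ r₈ r₉ z (fun v => cell (2 + n * n) 0 s.mem v ≠ 0) s' ∧
      s'.reg 4 = s'.reg 5 := by
    intro s₁ h₁
    refine Runs.loop I (fun s' => n - s'.reg 4) ?_ ?_ ?_ h₁
    · rintro t s' ⟨-, H'⟩
      have := H'.inv.le_n
      have := H'.inv.head_le
      simp only [fits_sub, fits_reg, eval_reg]
      omega
    · rintro t s' ⟨ht, H'⟩ h0
      have := H'.inv.head_le
      simp only [eval_sub, eval_reg] at h0
      have h45 : s'.reg 4 = s'.reg 5 := by omega
      refine ⟨?_, H', h45⟩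
      rw [← h45]
      simp only [cost_sub, cost_reg]
      omega
    · rintro t s' ⟨ht, H'⟩ h0
      have := H'.inv.le_n
      simp only [eval_sub, eval_reg] at h0
      refine (scan_runs hI H' (by omega)).mono ?_
      rintro t' s'' ⟨ht', H'', h4⟩
      refine ⟨⟨?_, H''⟩, by omega⟩
      simp only [cost_sub, cost_reg, h4, mul_add]
      omega
  obtain ⟨t₁, s₁, hx₁, ht₁, h₁⟩ := hpre
  obtain ⟨t₂, s₂, hx₂, ht₂, h₂⟩ := hloop s₁ h₁
  -- Sequential composition is nested to the right, so the run of the four initial assignments is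
  -- taken apart and regrouped with the loop.
  have hexec : ∃ t, t = t₁ + t₂ ∧ Exec B searchProgram s t s₂ := by
    cases hx₁ with
    | seq ha hx =>
      cases hx with
      | seq hb hx =>
        cases hx with
        | seq hc hd =>
          exact ⟨_, by omega, .seq ha (.seq hb (.seq hc (.seq hd hx₂)))⟩
  obtain ⟨t, rfl, hx⟩ := hexec
  refine ⟨_, _, hx, ?_, h₂⟩
  have : 84 * n + 4 ≤ 88 * n := by omega
  have := Nat.mul_le_mul_right (s₂.reg 5) this
  omega
end

/-! ## Connected vertex sets -/

/-- Every cut of the set `S` is crossed by an edge of `G` inside `S`, that is, `S` induces a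
preconnected subgraph. -/
def CutConnected {V : Type*} (G : SimpleGraph V) (S : Set V) : Prop :=
  ∀ A : Set V, (∃ x ∈ S, x ∈ A) → (∃ x ∈ S, x ∉ A) → ∃ u ∈ S, u ∈ A ∧ ∃ v ∈ S, v ∉ A ∧ G.Adj u v

/-- `G` has two disjoint connected sets of at least `k` vertices each. -/
def HasDisjointConnected {V : Type*} (G : SimpleGraph V) (k : ℕ) : Prop :=
  ∃ S T : Set V, Disjoint S T ∧ CutConnected G S ∧ CutConnected G T ∧ k ≤ S.ncard ∧ k ≤ T.ncard

namespace CutConnected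

variable {V : Type*} {G : SimpleGraph V} {S T : Set V}

theorem singleton (x : V) : CutConnected G {x} := by
  rintro A ⟨y, rfl, hy⟩ ⟨z, rfl, hz⟩
  exact (hz hy).elim

/-- A cut of `S` separates `c` from some vertex `v` of `S`, and is therefore crossed inside the
connected set that joins the two. -/
theorem of_star {c : V} (h : ∀ v ∈ S, ∃ P ⊆ S, CutConnected G P ∧ v ∈ P ∧ c ∈ P) :
    CutConnected G S := by
  rintro A ⟨x, hx, hxA⟩ ⟨y, hy, hyA⟩
  have : ∃ v ∈ S, (v ∈ A ↔ c ∉ A) := by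
    by_cases hc : c ∈ A
    · exact ⟨y, hy, by simp [hyA, hc]⟩
    · exact ⟨x, hx, by simp [hxA, hc]⟩
  obtain ⟨v, hv, hvc⟩ := this
  obtain ⟨P, hPS, hP, hvP, hcP⟩ := h v hv
  have : ∃ u ∈ P, u ∈ A ∧ ∃ v ∈ P, v ∉ A ∧ G.Adj u v := by
    by_cases hc : c ∈ A
    · exact hP A ⟨c, hcP, hc⟩ ⟨v, hvP, by tauto⟩
    · exact hP A ⟨v, hvP, by tauto⟩ ⟨c, hcP, hc⟩
  obtain ⟨u, hu, huA, w, hw, hwA, hadj⟩ := this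
  exact ⟨u, hPS hu, huA, w, hPS hw, hwA, hadj⟩

/-- A cut that splits neither `S` nor `T` separates them, and then the edge `x y` crosses it. -/
theorem union (hS : CutConnected G S) (hT : CutConnected G T) {x y : V} (hx : x ∈ S)
    (hy : y ∈ T) (hxy : G.Adj x y) : CutConnected G (S ∪ T) := by
  intro A hA hA'
  by_cases h1 : (∃ x ∈ S, x ∈ A) ∧ ∃ x ∈ S, x ∉ A
  · obtain ⟨u, hu, huA, w, hw, hwA, hadj⟩ := hS A h1.1 h1.2
    exact ⟨u, .inl hu, huA, w, .inl hw, hwA, hadj⟩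
  by_cases h2 : (∃ x ∈ T, x ∈ A) ∧ ∃ x ∈ T, x ∉ A
  · obtain ⟨u, hu, huA, w, hw, hwA, hadj⟩ := hT A h2.1 h2.2
    exact ⟨u, .inr hu, huA, w, .inr hw, hwA, hadj⟩
  by_cases hxA : x ∈ A <;> by_cases hyA : y ∈ A
  · obtain ⟨z, hz | hz, hzA⟩ := hA'
    · exact (h1 ⟨⟨x, hx, hxA⟩, z, hz, hzA⟩).elim
    · exact (h2 ⟨⟨y, hy, hyA⟩, z, hz, hzA⟩).elim
  · exact ⟨x, .inl hx, hxA, y, .inr hy, hyA, hxy⟩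
  · exact ⟨y, .inr hy, hyA, x, .inl hx, hxA, hxy.symm⟩
  · obtain ⟨z, hz | hz, hzA⟩ := hA
    · exact (h1 ⟨⟨z, hz, hzA⟩, x, hx, hxA⟩).elim
    · exact (h2 ⟨⟨z, hz, hzA⟩, y, hy, hyA⟩).elim

theorem insert (hS : CutConnected G S) {x y : V} (hx : x ∈ S) (hxy : G.Adj x y) :
    CutConnected G (insert y S) := by
  rw [Set.insert_eq, Set.union_comm]
  exact hS.union (singleton y) hx rfl hxy

theorem image_prefix {q : ℕ → V} {m : ℕ}
    (h : ∀ i < m, 0 < i → ∃ j < i, G.Adj (q j) (q i)) :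
    CutConnected G (q '' Set.Iio m) := by
  induction m with
  | zero =>
    rintro A ⟨x, ⟨i, hi, -⟩, -⟩
    exact absurd hi (Nat.not_lt_zero i)
  | succ m ih =>
    have hm : q '' Set.Iio (m + 1) = Insert.insert (q m) (q '' Set.Iio m) := by
      rw [← Set.image_insert_eq]
      congr 1
      ext i
      simp
    rw [hm]
    rcases Nat.eq_zero_or_pos m with rfl | h0
    · have : (Set.Iio 0 : Set ℕ) = ∅ := by ext; simp
      rw [this, Set.image_empty, insert_empty_eq]
      exact singleton _
    · obtain ⟨j, hj, hadj⟩ := h m (by omega) h0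
      exact (ih fun i hi => h i (by omega)).insert ⟨j, hj, rfl⟩ hadj

end CutConnected

/-! ### A vertex whose removal leaves only small pieces -/

section Pieces

variable {V : Type*} [Fintype V] {G : SimpleGraph V} {k : ℕ}

/-- The sets `P v` partition the vertices other than `c` into small connected pieces adjacent to
`c`. Pieces are united along `D` until the union first reaches `k` vertices; the last piece added
overshoots by little, and the remaining pieces stay connected through `c`. -/
theorem hasDisjointConnected_of_pieces {c : V} {P : V → Set V} (hk : 0 < k)
    (hV : 3 * k ≤ Fintype.card V + 2)
    (hmem : ∀ v, v ≠ c → v ∈ P v) (hc : ∀ v, v ≠ c → c ∉ P v)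
    (hsat : ∀ v, v ≠ c → ∀ w ∈ P v, P w = P v) (hconn : ∀ v, v ≠ c → CutConnected G (P v))
    (hcard : ∀ v, v ≠ c → (P v).ncard < k) (hadj : ∀ v, v ≠ c → ∃ w ∈ P v, G.Adj w c)
    {D : Set V} (hD : CutConnected G D) (hcD : c ∉ D) (hDk : k ≤ D.ncard) :
    HasDisjointConnected G k := by
  -- The unions of pieces that are connected, meet `D` and are still too small. A largest one, `A`,
  -- cannot contain `D`, so an edge of `D` leaves it, and the piece at the far end of that edge is
  -- added.
  let F : Set (Set V) := {A | CutConnected G A ∧ c ∉ A ∧ (∃ x ∈ D, x ∈ A) ∧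
    (∀ w ∈ A, P w ⊆ A) ∧ A.ncard < k}
  have hne : F.Nonempty := by
    obtain ⟨d, hd⟩ : D.Nonempty := by
      rw [← Set.ncard_pos]
      omega
    have hdc : d ≠ c := fun h => hcD (h ▸ hd)
    exact ⟨P d, hconn d hdc, hc d hdc, ⟨d, hd, hmem d hdc⟩,
      fun w hw => (hsat d hdc w hw).subset, hcard d hdc⟩
  obtain ⟨A, ⟨hA, hcA, hAD, hAsat, hAk⟩, hmax⟩ :=
    Set.exists_max_image F Set.ncard (Set.toFinite F) hne
  have hDA : ∃ x ∈ D, x ∉ A := by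
    by_contra! h
    have := Set.ncard_le_ncard (show D ⊆ A from h)
    omega
  obtain ⟨u, hu, huA, v, hv, hvA, huv⟩ := hD A hAD hDA
  have hvc : v ≠ c := fun h => hcD (h ▸ hv)
  have hsat' : ∀ w ∈ A ∪ P v, P w ⊆ A ∪ P v := by
    rintro w (hw | hw)
    · exact (hAsat w hw).trans Set.subset_union_left
    · exact (hsat v hvc w hw).subset.trans Set.subset_union_right
  have hconn' : CutConnected G (A ∪ P v) := hA.union (hconn v hvc) huA (hmem v hvc) huv
  have hc' : c ∉ A ∪ P v := by
    rintro (h | h)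
    · exact hcA h
    · exact hc v hvc h
  have hle : (A ∪ P v).ncard ≤ A.ncard + (P v).ncard := Set.ncard_union_le _ _
  have hlt : A.ncard < (A ∪ P v).ncard := Set.ncard_lt_ncard
    ⟨Set.subset_union_left, fun h => hvA (h (.inr (hmem v hvc)))⟩
  have hk' : k ≤ (A ∪ P v).ncard := by
    by_contra! h
    have := hmax (A ∪ P v) ⟨hconn', hc', ⟨u, hu, .inl huA⟩, hsat', h⟩
    omega
  refine ⟨A ∪ P v, (A ∪ P v)ᶜ, disjoint_compl_right, hconn', ?_, hk', ?_⟩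
  -- The complement consists of `c` and whole pieces, each attached to `c`.
  · refine CutConnected.of_star (c := c) fun x hx => ?_
    by_cases hxc : x = c
    · subst hxc
      exact ⟨{x}, by simpa using hc', .singleton x, rfl, rfl⟩
    · obtain ⟨w, hw, hwc⟩ := hadj x hxc
      refine ⟨insert c (P x), ?_, (hconn x hxc).insert hw hwc, .inr (hmem x hxc), .inl rfl⟩
      rintro y (rfl | hy)
      · exact hc'
      · intro hy'
        have := hsat' y hy'
        rw [hsat x hxc y hy] at this
        exact hx (this (hmem x hxc))
  -- Both `A` and `P v` have at most `k - 1` vertices, so the complement has at least `n - (2 * k -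
  -- 2)`. This is where `3 * k ≤ n + 2` enters.
  · have := Set.ncard_add_ncard_compl (A ∪ P v)
    rw [Nat.card_eq_fintype_card] at this
    have := hcard v hvc
    omega

end Pieces

/-! ## Merging subtrees -/

/-- The vertices `q 0, …, q (n - 1)` form a tree in which `q (p i)` is the parent of `q i`.
The subtrees of all vertices behind the `i`-th have been merged into their parents: `L x` is the
root of the subtree that now contains `x`, it has `z (L x) + 1` vertices, and `M x` is the child
of that root below which `x` lies. All these lower subtrees have less than `k` vertices. -/
structure MergeInv {V : Type*} (G : SimpleGraph V) (q : ℕ → V) (n k : ℕ) (z : ℕ → ℕ) (i : ℕ)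
    (L M : ℕ → ℕ) : Prop where
  lt : i < n
  label_le : ∀ x < n, L x ≤ i
  label_self : ∀ r ≤ i, L r = r
  size : ∀ r ≤ i, z r + 1 = ((Finset.range n).filter fun x => L x = r).card
  conn : ∀ r ≤ i, CutConnected G (q '' {x | x < n ∧ L x = r})
  piece_gt : ∀ x < n, i < x → i < M x
  piece_label : ∀ x < n, i < x → ∀ y < n, i < y → M y = M x → L y = L x
  piece_conn : ∀ x < n, i < x → CutConnected G (q '' {y | y < n ∧ i < y ∧ M y = M x})
  piece_card : ∀ x < n, i < x → (q '' {y | y < n ∧ i < y ∧ M y = M x}).ncard < k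
  piece_adj : ∀ x < n, i < x → ∃ y < n, i < y ∧ M y = M x ∧ G.Adj (q y) (q (L x))

namespace MergeInv

variable {V : Type*} {G : SimpleGraph V} {q : ℕ → V} {n k : ℕ} {p z : ℕ → ℕ} {i : ℕ}
  {L M : ℕ → ℕ}

/-- Every vertex is its own subtree, and no index exceeds `n - 1`, so there are no pieces. Storing
size minus one makes cleared memory the correct initial value. -/
theorem init (hn : 0 < n) : MergeInv G q n k (fun _ => 0) (n - 1) id id where
  lt := by omega
  label_le x hx := by simp; omega
  label_self r _ := rfl
  size r hr := by
    have : (Finset.range n).filter (fun x => id x = r) = {r} := by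
      ext x
      simp only [Finset.mem_filter, Finset.mem_range, id, Finset.mem_singleton]
      omega
    rw [this]
    simp
  conn r hr := by
    have : {x | x < n ∧ id x = r} = {r} := by
      ext x
      simp only [Set.mem_ofPred_eq, id, Set.mem_singleton_iff]
      omega
    rw [this, Set.image_singleton]
    exact .singleton _
  piece_gt x hx hx' := by omega
  piece_label x hx hx' := by omega
  piece_conn x hx hx' := by omega
  piece_card x hx hx' := by omega
  piece_adj x hx hx' := by omega

theorem class_pos (H : MergeInv G q n k z i L M) {x : ℕ} (hx : x < i) : L x ≠ i := by
  rw [H.label_self x hx.le]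
  omega

/-- The class of `i` is joined to that of `p i` by a tree edge and becomes a new piece below it. It
is small because merging happens only while `z i + 1 < k`; all other pieces are unchanged. -/
theorem merge (H : MergeInv G q n k z i L M) (hi : 0 < i) (hp : p i < i)
    (hadj : G.Adj (q (p i)) (q i)) (hz : z i + 1 < k) :
    MergeInv G q n k (Function.update z (p i) (z (p i) + (z i + 1))) (i - 1)
      (fun x => if L x = i then p i else L x) (fun x => if L x = i then i else M x) := by
  have hLi := H.label_self i le_rfl
  have hLp := H.label_self (p i) hp.le
  have hlt := H.lt
  have hgt : ∀ x, i - 1 < x → L x ≠ i → i < x := fun x hx hL => by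
    rcases eq_or_ne x i with rfl | hne
    · exact (hL hLi).elim
    · omega
  have hge : ∀ x, L x = i → i - 1 < x := fun x hL => by
    by_contra h
    exact H.class_pos (by omega) hL
  -- The new piece, with name `i`, is exactly the old class of `i`: the names of older pieces exceed
  -- `i`.
  have hpi : {y | y < n ∧ i - 1 < y ∧ (if L y = i then i else M y) = i} =
      {y | y < n ∧ L y = i} := by
    ext y
    simp only [Set.mem_ofPred_eq]
    constructor
    · rintro ⟨hy, hy', h⟩
      refine ⟨hy, ?_⟩
      by_contra hL
      rw [if_neg hL] at h
      have := H.piece_gt y hy (hgt y hy' hL)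
      omega
    · rintro ⟨hy, hL⟩
      exact ⟨hy, hge y hL, if_pos hL⟩
  have hpo : ∀ x < n, i < x → L x ≠ i →
      {y | y < n ∧ i - 1 < y ∧ (if L y = i then i else M y) = M x} =
      {y | y < n ∧ i < y ∧ M y = M x} := by
    intro x hx hix hLx
    have hMx := H.piece_gt x hx hix
    ext y
    simp only [Set.mem_ofPred_eq]
    constructor
    · rintro ⟨hy, hy', h⟩
      split_ifs at h with hL
      · omega
      · exact ⟨hy, hgt y hy' hL, h⟩
    · rintro ⟨hy, hy', h⟩
      have := H.piece_label x hx hix y hy hy' h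
      exact ⟨hy, by omega, by rw [if_neg (by omega), h]⟩
  have hcard : (q '' {x | x < n ∧ L x = i}).ncard < k := by
    refine lt_of_le_of_lt (Set.ncard_image_le (Set.finite_lt_nat n |>.subset fun x h => h.1)) ?_
    have : {x | x < n ∧ L x = i} = ((Finset.range n).filter fun x => L x = i : Set ℕ) := by
      ext; simp
    rw [this, Set.ncard_coe_finset, ← H.size i le_rfl]
    exact hz
  refine ⟨by omega, ?_, ?_, ?_, ?_, ?_, ?_, ?_, ?_, ?_⟩
  · intro x hx
    have := H.label_le x hx
    split_ifs <;> omega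
  · intro r hr
    have := H.label_self r (by omega)
    rw [if_neg (by omega), this]
  · intro r hr
    have hr' := H.size r (by omega)
    have hi' := H.size i le_rfl
    rcases eq_or_ne r (p i) with rfl | hne
    · rw [Function.update_self]
      have : (Finset.range n).filter (fun x => (if L x = i then p i else L x) = p i) =
          (Finset.range n).filter (fun x => L x = p i) ∪
            (Finset.range n).filter (fun x => L x = i) := by
        ext x
        simp only [Finset.mem_filter, Finset.mem_union]
        split_ifs with h
        · simp only [h, and_true]
          tauto
        · simp [h]
      rw [this, Finset.card_union_of_disjoint, ← hr', ← hi']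
      · omega
      · rw [Finset.disjoint_filter]
        intro x _ h
        omega
    · rw [Function.update_of_ne hne, hr']
      congr 1
      refine Finset.filter_congr fun x _ => ?_
      split_ifs with h
      · constructor <;> intro <;> omega
      · rfl
  · intro r hr
    rcases eq_or_ne r (p i) with rfl | hne
    · have : {x | x < n ∧ (if L x = i then p i else L x) = p i} =
          {x | x < n ∧ L x = p i} ∪ {x | x < n ∧ L x = i} := by
        ext x
        simp only [Set.mem_ofPred_eq, Set.mem_union]
        split_ifs with h
        · simp only [h, and_true]
          tauto
        · simp [h]
      rw [this, Set.image_union]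
      exact (H.conn _ hp.le).union (H.conn i le_rfl) ⟨p i, ⟨by omega, hLp⟩, rfl⟩
        ⟨i, ⟨hlt, hLi⟩, rfl⟩ hadj
    · have : {x | x < n ∧ (if L x = i then p i else L x) = r} = {x | x < n ∧ L x = r} := by
        ext x
        simp only [Set.mem_ofPred_eq]
        split_ifs with h
        · constructor <;> rintro ⟨h1, h2⟩ <;> omega
        · rfl
      rw [this]
      exact H.conn r (by omega)
  · intro x hx hix
    split_ifs with h
    · omega
    · have := H.piece_gt x hx (hgt x hix h)
      omega
  · intro x hx hix y hy hiy hM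
    split_ifs at hM with h1 h2 h2
    · rw [if_pos h1, if_pos h2]
    · have := H.piece_gt x hx (hgt x hix h2)
      omega
    · have := H.piece_gt y hy (hgt y hiy h1)
      omega
    · rw [if_neg h1, if_neg h2]
      exact H.piece_label x hx (hgt x hix h2) y hy (hgt y hiy h1) hM
  · intro x hx hix
    split_ifs with h
    · rw [hpi]
      exact H.conn i le_rfl
    · rw [hpo x hx (hgt x hix h) h]
      exact H.piece_conn x hx (hgt x hix h)
  · intro x hx hix
    split_ifs with h
    · rwa [hpi]
    · rw [hpo x hx (hgt x hix h) h]
      exact H.piece_card x hx (hgt x hix h)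
  · intro x hx hix
    by_cases h : L x = i
    · simp only [if_pos h]
      exact ⟨i, hlt, by omega, by rw [if_pos hLi], hadj.symm⟩
    · simp only [if_neg h]
      obtain ⟨y, hy, hiy, hM, hE⟩ := H.piece_adj x hx (hgt x hix h)
      have := H.piece_label x hx (hgt x hix h) y hy hiy hM
      exact ⟨y, hy, by omega, by rw [if_neg (by omega), hM], hE⟩

/-- Indices up to `i` are still roots of their classes, so the tree edge from `m` to `p m` attaches
the class of `m` to an earlier one. -/
theorem conn_below (H : MergeInv G q n k z i L M)
    (hp : ∀ j < n, 0 < j → p j < j ∧ G.Adj (q (p j)) (q j)) {m : ℕ} (hm : m ≤ i) :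
    CutConnected G (q '' {x | x < n ∧ L x < m}) := by
  have hlt := H.lt
  induction m with
  | zero =>
    rintro A ⟨x, ⟨j, ⟨-, hj⟩, -⟩, -⟩
    exact absurd hj (Nat.not_lt_zero _)
  | succ m ih =>
    have hm' : {x | x < n ∧ L x < m + 1} = {x | x < n ∧ L x < m} ∪ {x | x < n ∧ L x = m} := by
      ext x
      simp only [Set.mem_ofPred_eq, Set.mem_union]
      omega
    rcases Nat.eq_zero_or_pos m with rfl | h0
    · have : {x | x < n ∧ L x < 0} = ∅ := by ext; simp
      rw [hm', this, Set.empty_union]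
      exact H.conn 0 (by omega)
    · have h1 := H.label_self m (by omega)
      have h2 := hp m (by omega) h0
      have h3 := H.label_self (p m) (by omega)
      rw [hm', Set.image_union]
      exact (ih (by omega)).union (H.conn m (by omega)) ⟨p m, ⟨by omega, by omega⟩, rfl⟩
        ⟨m, ⟨by omega, h1⟩, rfl⟩ h2.2

/-- This makes `q i` a pivot: the question about two sets reduces to the components of `G - q i`. If
the part `U` of the tree outside the subtree of `q i` is large, it is paired with that subtree;
otherwise `U` and the subtrees below `q i` are the small pieces of `hasDisjointConnected_of_pieces`.
-/
theorem hasDisjointConnected_iff [Fintype V] (H : MergeInv G q n k z i L M) (hk : 0 < k)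
    (hV : Fintype.card V = n) (hn : 3 * k ≤ n + 2) (hinj : Set.InjOn q (Set.Iio n))
    (hsurj : ∀ v, ∃ j < n, q j = v)
    (hp : ∀ j < n, 0 < j → p j < j ∧ G.Adj (q (p j)) (q j)) (hz : k ≤ z i + 1) :
    HasDisjointConnected G k ↔ ∃ D : Set V, CutConnected G D ∧ q i ∉ D ∧ k ≤ D.ncard := by
  have hlt := H.lt
  constructor
  · rintro ⟨S, T, hST, hS, hT, hSk, hTk⟩
    by_cases h : q i ∈ S
    · exact ⟨T, hT, Set.disjoint_left.1 hST h, hTk⟩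
    · exact ⟨S, hS, h, hSk⟩
  rintro ⟨D, hD, hcD, hDk⟩
  set U := q '' {x | x < n ∧ L x < i} with hU
  have hUc : CutConnected G U := H.conn_below hp le_rfl
  by_cases hUk : k ≤ U.ncard
  · refine ⟨_, U, ?_, H.conn i le_rfl, hUc, ?_, hUk⟩
    · rw [Set.disjoint_left]
      rintro _ ⟨x, ⟨hx, hLx⟩, rfl⟩ ⟨y, ⟨hy, hLy⟩, hxy⟩
      have := hinj hy hx hxy
      subst this
      omega
    · rw [(hinj.mono fun x hx => hx.1).ncard_image]
      have : {x | x < n ∧ L x = i} = ((Finset.range n).filter fun x => L x = i : Set ℕ) := by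
        ext; simp
      rw [this, Set.ncard_coe_finset, ← H.size i le_rfl]
      exact hz
  push Not at hUk
  choose r hr hqr using hsurj
  have hrq : ∀ x < n, r (q x) = x := fun x hx => hinj (hr _) hx (hqr _)
  have hne : ∀ v, v ≠ q i → r v ≠ i := fun v hv h => hv (by rw [← h, hqr])
  have hgt : ∀ v, v ≠ q i → ¬ L (r v) < i → i < r v := fun v hv h => by
    have h1 := hne v hv
    by_contra h2
    have := H.label_self (r v) (by omega)
    omega
  have hmemU : ∀ v, v ∈ U ↔ L (r v) < i := fun v => by
    constructor
    · rintro ⟨x, ⟨hx, hL⟩, rfl⟩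
      rwa [hrq x hx]
    · intro h
      exact ⟨r v, ⟨hr v, h⟩, hqr v⟩
  -- The value at `q i` itself is irrelevant. For other vertices outside `U`, the piece is the child
  -- subtree of `q i` named by `M`.
  let P : V → Set V := fun v => if L (r v) < i then U else
    q '' {y | y < n ∧ i < y ∧ M y = M (r v)}
  have hPU : ∀ v, L (r v) < i → P v = U := fun v h => if_pos h
  have hPM : ∀ v, ¬ L (r v) < i → P v = q '' {y | y < n ∧ i < y ∧ M y = M (r v)} :=
    fun v h => if_neg h
  refine hasDisjointConnected_of_pieces (c := q i) (P := P) hk (by omega) ?_ ?_ ?_ ?_ ?_ ?_ hD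
    hcD hDk
  · intro v hv
    by_cases h : L (r v) < i
    · rw [hPU v h]
      exact (hmemU v).2 h
    · rw [hPM v h]
      exact ⟨r v, ⟨hr v, hgt v hv h, rfl⟩, hqr v⟩
  · intro v hv
    by_cases h : L (r v) < i
    · rw [hPU v h, hmemU, hrq i hlt, H.label_self i le_rfl]
      omega
    · rw [hPM v h]
      rintro ⟨y, ⟨hy, hy', -⟩, hyi⟩
      have := hinj hy hlt hyi
      omega
  · intro v hv w hw
    by_cases h : L (r v) < i
    · rw [hPU v h] at hw ⊢
      exact hPU w ((hmemU w).1 hw)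
    · rw [hPM v h] at hw ⊢
      obtain ⟨y, ⟨hy, hy', hM⟩, rfl⟩ := hw
      have := H.piece_label (r v) (hr v) (hgt v hv h) y hy hy' hM
      rw [hPM _ (by rw [hrq y hy]; omega), hrq y hy, hM]
  · intro v hv
    by_cases h : L (r v) < i
    · rwa [hPU v h]
    · rw [hPM v h]
      exact H.piece_conn _ (hr v) (hgt v hv h)
  · intro v hv
    by_cases h : L (r v) < i
    · rwa [hPU v h]
    · rw [hPM v h]
      exact H.piece_card _ (hr v) (hgt v hv h)
  · intro v hv
    by_cases h : L (r v) < i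
    · rw [hPU v h]
      have h1 := hp i hlt (by omega)
      have h2 := H.label_self (p i) (by omega)
      exact ⟨q (p i), (hmemU _).2 (by rw [hrq _ (by omega)]; omega), h1.2⟩
    · rw [hPM v h]
      obtain ⟨y, hy, hy', hM, hE⟩ := H.piece_adj _ (hr v) (hgt v hv h)
      have h1 := H.label_le (r v) (hr v)
      have h2 : L (r v) = i := by omega
      exact ⟨q y, ⟨y, ⟨hy, hy', hM⟩, rfl⟩, h2 ▸ hE⟩

end MergeInv

/-! ## Restricted edge-cuts and disjoint connected sets -/

section RestrictedCuts

variable {V : Type*} {G : SimpleGraph V} {k : ℕ}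

theorem SimpleGraph.Reachable.exists_adj_boundary {x y : V} (h : G.Reachable x y) {A : Set V}
    (hx : x ∈ A) (hy : y ∉ A) : ∃ u ∈ A, ∃ v ∉ A, G.Adj u v := by
  obtain ⟨w⟩ := h
  obtain ⟨d, -, h1, h2⟩ := w.exists_boundary_dart A hx hy
  exact ⟨d.fst, h1, d.snd, h2, d.adj⟩

theorem SimpleGraph.ConnectedComponent.cutConnected_supp (c : G.ConnectedComponent) :
    CutConnected G c.supp := by
  rintro A ⟨x, hx, hxA⟩ ⟨y, hy, hyA⟩
  have hxy : G.Reachable x y := SimpleGraph.ConnectedComponent.exact (hx.trans hy.symm)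
  obtain ⟨u, ⟨huA, hu⟩, v, hv, hadj⟩ :=
    hxy.exists_adj_boundary (A := A ∩ c.supp) ⟨hxA, hx⟩ fun h => hyA h.1
  have hvc : v ∈ c.supp := (SimpleGraph.ConnectedComponent.connectedComponentMk_eq_of_adj
    hadj).symm.trans hu
  exact ⟨u, hu, huA, v, hvc, fun h => hv ⟨h, hvc⟩, hadj⟩

theorem CutConnected.mono_graph {H : SimpleGraph V} {S : Set V} (hS : CutConnected H S)
    (h : H ≤ G) : CutConnected G S := fun A h1 h2 => by
  obtain ⟨u, hu, huA, v, hv, hvA, hadj⟩ := hS A h1 h2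
  exact ⟨u, hu, huA, v, hv, hvA, h hadj⟩

theorem CutConnected.reachable {S : Set V} (hS : CutConnected G S) {x y : V} (hx : x ∈ S)
    (hy : y ∈ S) : G.Reachable x y := by
  by_contra h
  obtain ⟨u, -, hu, v, -, hv, hadj⟩ :=
    hS {v | G.Reachable x v} ⟨x, hx, SimpleGraph.Reachable.refl x⟩ ⟨y, hy, h⟩
  exact hv (SimpleGraph.Reachable.trans hu hadj.reachable)

/-- A pair with the largest total size covers all vertices: otherwise an edge of the connected graph
leaves the union, and its outer end can be added to one of the sets. -/
theorem HasDisjointConnected.exists_partition [Finite V] (hG : G.Connected) (hk : 0 < k)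
    (h : HasDisjointConnected G k) : ∃ S T : Set V, Disjoint S T ∧ S ∪ T = Set.univ ∧
      CutConnected G S ∧ CutConnected G T ∧ k ≤ S.ncard ∧ k ≤ T.ncard := by
  let F : Set (Set V × Set V) := {P | Disjoint P.1 P.2 ∧ CutConnected G P.1 ∧
    CutConnected G P.2 ∧ k ≤ P.1.ncard ∧ k ≤ P.2.ncard}
  have hF : F.Nonempty := by
    obtain ⟨S, T, h⟩ := h
    exact ⟨(S, T), h⟩
  obtain ⟨⟨S, T⟩, ⟨hST, hS, hT, hSk, hTk⟩, hmax⟩ :=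
    Set.exists_max_image F (fun P => P.1.ncard + P.2.ncard) (Set.toFinite F) hF
  dsimp only at hST hS hT hSk hTk
  refine ⟨S, T, hST, ?_, hS, hT, hSk, hTk⟩
  by_contra hne
  obtain ⟨y, hy⟩ := (Set.ne_univ_iff_exists_notMem _).1 hne
  obtain ⟨x, hx⟩ : S.Nonempty := by
    rw [← Set.ncard_pos]
    exact hk.trans_le hSk
  obtain ⟨u, hu, v, hv, hadj⟩ :=
    (hG.preconnected x y).exists_adj_boundary (A := S ∪ T) (.inl hx) hy
  have hvS : v ∉ S := fun h => hv (.inl h)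
  have hvT : v ∉ T := fun h => hv (.inr h)
  rcases hu with hu | hu
  · have h1 := Set.ncard_insert_of_notMem hvS
    have := hmax (insert v S, T) ⟨Set.disjoint_insert_left.2 ⟨hvT, hST⟩, hS.insert hu hadj, hT,
      by dsimp only; omega, hTk⟩
    dsimp only at this
    omega
  · have h1 := Set.ncard_insert_of_notMem hvT
    have := hmax (S, insert v T) ⟨Set.disjoint_insert_right.2 ⟨hvS, hST⟩, hS, hT.insert hu hadj,
      hSk, by dsimp only; omega⟩
    dsimp only at this
    omega

/-- The cut consists of the edges between `S` and `T`. It destroys no edge inside either set, so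
each remaining component contains one of them. -/
theorem exists_isRestrictedEdgeCut_of_partition [Finite V] (hG : G.Connected) (hk : 0 < k)
    {S T : Set V} (hST : Disjoint S T) (hU : S ∪ T = Set.univ) (hS : CutConnected G S)
    (hT : CutConnected G T) (hSk : k ≤ S.ncard) (hTk : k ≤ T.ncard) :
    ∃ F : Set (Sym2 V), IsRestrictedEdgeCut G k F := by
  obtain ⟨x, hx⟩ : S.Nonempty := by
    rw [← Set.ncard_pos]
    exact hk.trans_le hSk
  obtain ⟨y, hy⟩ : T.Nonempty := by
    rw [← Set.ncard_pos]
    exact hk.trans_le hTk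
  have hyS : y ∉ S := Set.disjoint_right.1 hST hy
  have hmem : ∀ v, v ∈ S ∨ v ∈ T := fun v => by
    have : v ∈ S ∪ T := hU ▸ Set.mem_univ v
    exact this
  let F : Set (Sym2 V) := {e | ∃ u ∈ S, ∃ v ∈ T, e = s(u, v) ∧ G.Adj u v}
  have hin : ∀ u v, (u ∈ S ↔ v ∈ S) → s(u, v) ∉ F := by
    rintro u v huv ⟨a, ha, b, hb, hab, -⟩
    have hbS := Set.disjoint_right.1 hST hb
    rcases Sym2.eq_iff.1 hab with ⟨rfl, rfl⟩ | ⟨rfl, rfl⟩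
    · exact hbS (huv.1 ha)
    · exact hbS (huv.2 ha)
  have hS' : CutConnected (G.deleteEdges F) S := fun A h1 h2 => by
    obtain ⟨u, hu, huA, v, hv, hvA, hadj⟩ := hS A h1 h2
    exact ⟨u, hu, huA, v, hv, hvA, (SimpleGraph.deleteEdges_adj).2
      ⟨hadj, hin u v (by simp [hu, hv])⟩⟩
  have hT' : CutConnected (G.deleteEdges F) T := fun A h1 h2 => by
    obtain ⟨u, hu, huA, v, hv, hvA, hadj⟩ := hT A h1 h2
    exact ⟨u, hu, huA, v, hv, hvA, (SimpleGraph.deleteEdges_adj).2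
      ⟨hadj, hin u v (by simp [Set.disjoint_right.1 hST hu, Set.disjoint_right.1 hST hv])⟩⟩
  refine ⟨F, ⟨?_, ?_, ?_⟩, ?_⟩
  · obtain ⟨u, hu, v, hv, hadj⟩ := (hG.preconnected x y).exists_adj_boundary hx hyS
    exact ⟨s(u, v), u, hu, v, (hmem v).resolve_left hv, rfl, hadj⟩
  · rintro e ⟨u, -, v, -, rfl, hadj⟩
    exact hadj
  · intro hp
    obtain ⟨u, hu, v, hv, hadj⟩ := (hp x y).exists_adj_boundary hx hyS
    rw [SimpleGraph.deleteEdges_adj] at hadj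
    exact hadj.2 ⟨u, hu, v, (hmem v).resolve_left hv, rfl, hadj.1⟩
  · intro c
    induction c using SimpleGraph.ConnectedComponent.ind with
    | _ v =>
      rcases hmem v with hv | hv
      · exact hSk.trans (Set.ncard_le_ncard fun w hw =>
          SimpleGraph.ConnectedComponent.sound (hS'.reachable hw hv))
      · exact hTk.trans (Set.ncard_le_ncard fun w hw =>
          SimpleGraph.ConnectedComponent.sound (hT'.reachable hw hv))

theorem IsRestrictedEdgeCut.hasDisjointConnected [Finite V] {F : Set (Sym2 V)}
    (h : IsRestrictedEdgeCut G k F) : HasDisjointConnected G k := by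
  obtain ⟨⟨-, -, hnp⟩, hc⟩ := h
  rw [SimpleGraph.Preconnected] at hnp
  push Not at hnp
  obtain ⟨x, y, hxy⟩ := hnp
  have hle := G.deleteEdges_le F
  refine ⟨((G.deleteEdges F).connectedComponentMk x).supp,
    ((G.deleteEdges F).connectedComponentMk y).supp, ?_,
    (SimpleGraph.ConnectedComponent.cutConnected_supp _).mono_graph hle,
    (SimpleGraph.ConnectedComponent.cutConnected_supp _).mono_graph hle, hc _, hc _⟩
  rw [Set.disjoint_left]
  intro v hv hv'
  exact hxy (SimpleGraph.ConnectedComponent.exact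
    ((Eq.symm hv).trans hv'))

/-- Once some restricted cut exists, the minimum exists because the sizes are natural numbers. -/
theorem isLambdaConnected_iff [Finite V] (hG : G.Connected) (hk : 0 < k) :
    IsLambdaConnected G k ↔ HasDisjointConnected G k := by
  constructor
  · rintro ⟨-, m, ⟨F, hF, -⟩, -⟩
    exact hF.hasDisjointConnected
  · intro h
    obtain ⟨S, T, hST, hU, hS, hT, hSk, hTk⟩ := h.exists_partition hG hk
    obtain ⟨F, hF⟩ := exists_isRestrictedEdgeCut_of_partition hG hk hST hU hS hT hSk hTk
    exact ⟨hG, _, Nat.sInf_mem ⟨_, F, hF, rfl⟩, fun _ hm => Nat.sInf_le hm⟩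

theorem HasDisjointConnected.two_mul_le [Fintype V] (h : HasDisjointConnected G k) :
    2 * k ≤ Fintype.card V := by
  obtain ⟨S, T, hST, -, -, hSk, hTk⟩ := h
  have h1 := Set.ncard_union_eq hST
  have h2 := Set.ncard_le_ncard (Set.subset_univ (S ∪ T))
  rw [Set.ncard_univ, Nat.card_eq_fintype_card] at h2
  omega

end RestrictedCuts

/-! ### Pairs of connected sets as vertex sequences -/

section Sequences

variable {V : Type*} {G : SimpleGraph V} {k : ℕ}

/-- The sequences `f 0, …, f (k - 1)` and `f k, …, f (2 * k - 1)` together list `2 * k`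
distinct vertices, and in both of them each vertex but the first has an earlier neighbour. -/
def IsGrowing (E : V → V → Prop) (k : ℕ) (f : ℕ → V) : Prop :=
  ∀ i < 2 * k, (∀ j < i, f j ≠ f i) ∧ (i % k = 0 ∨ ∃ j < i, j / k = i / k ∧ E (f j) (f i))

/-- Greedy choice: fewer than `k` listed vertices do not exhaust `S`, so connectedness gives an edge
from a listed vertex to an unlisted one. -/
theorem CutConnected.exists_sequence [Finite V] {S : Set V} (hS : CutConnected G S)
    (hk : 0 < k) (hSk : k ≤ S.ncard) : ∃ q : ℕ → V, ∀ i < k, q i ∈ S ∧ (∀ j < i, q j ≠ q i) ∧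
      (0 < i → ∃ j < i, G.Adj (q j) (q i)) := by
  obtain ⟨x, hx⟩ : S.Nonempty := by
    rw [← Set.ncard_pos]
    exact hk.trans_le hSk
  suffices h : ∀ m ≤ k, ∃ q : ℕ → V, ∀ i < m, q i ∈ S ∧ (∀ j < i, q j ≠ q i) ∧
      (0 < i → ∃ j < i, G.Adj (q j) (q i)) from h k le_rfl
  intro m
  induction m with
  | zero => exact fun _ => ⟨fun _ => x, fun i hi => absurd hi (Nat.not_lt_zero i)⟩
  | succ m ih =>
    intro hm
    obtain ⟨q, hq⟩ := ih (by omega)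
    have hstep : ∃ v ∈ S, (∀ j < m, q j ≠ v) ∧ (0 < m → ∃ j < m, G.Adj (q j) v) := by
      rcases Nat.eq_zero_or_pos m with rfl | h0
      · exact ⟨x, hx, fun j hj => absurd hj (Nat.not_lt_zero j), fun h => absurd h (lt_irrefl 0)⟩
      · have hout : ∃ y ∈ S, y ∉ q '' Set.Iio m := by
          by_contra! h
          have h1 := Set.ncard_le_ncard (show S ⊆ q '' Set.Iio m from h)
            ((Set.finite_Iio m).image q)
          have h2 : (q '' Set.Iio m).ncard ≤ (Set.Iio m).ncard :=
            Set.ncard_image_le (Set.finite_Iio m)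
          rw [Set.ncard_Iio_nat] at h2
          omega
        obtain ⟨u, hu, ⟨j, hj, rfl⟩, v, hv, hvA, hadj⟩ :=
          hS (q '' Set.Iio m) ⟨q 0, (hq 0 h0).1, 0, h0, rfl⟩ hout
        exact ⟨v, hv, fun j hj h => hvA ⟨j, hj, h⟩, fun _ => ⟨j, hj, hadj⟩⟩
    obtain ⟨v, hv, hne, hadj⟩ := hstep
    have hold : ∀ i < m, Function.update q m v i = q i := fun i hi =>
      Function.update_of_ne (by omega) _ _
    refine ⟨Function.update q m v, fun i hi => ?_⟩
    rcases Nat.lt_succ_iff_lt_or_eq.1 hi with hi | rfl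
    · obtain ⟨h1, h2, h3⟩ := hq i hi
      rw [hold i hi]
      refine ⟨h1, fun j hj => ?_, fun h0 => ?_⟩
      · rw [hold j (by omega)]
        exact h2 j hj
      · obtain ⟨j, hj, h⟩ := h3 h0
        exact ⟨j, hj, by rwa [hold j (by omega)]⟩
    · rw [Function.update_self]
      refine ⟨hv, fun j hj => ?_, fun h0 => ?_⟩
      · rw [hold j hj]
        exact hne j hj
      · obtain ⟨j, hj, h⟩ := hadj h0
        exact ⟨j, hj, by rwa [hold j hj]⟩

theorem hasDisjointConnected_iff_exists_isGrowing [Finite V] (hk : 0 < k) :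
    HasDisjointConnected G k ↔ ∃ f : ℕ → V, IsGrowing G.Adj k f := by
  constructor
  · rintro ⟨S, T, hST, hS, hT, hSk, hTk⟩
    obtain ⟨q, hq⟩ := hS.exists_sequence hk hSk
    obtain ⟨r, hr⟩ := hT.exists_sequence hk hTk
    have hf1 : ∀ i < k, (fun i => if i < k then q i else r (i - k)) i = q i := fun i hi =>
      if_pos hi
    have hf2 : ∀ i, ¬ i < k → (fun i => if i < k then q i else r (i - k)) i = r (i - k) :=
      fun i hi => if_neg hi
    refine ⟨fun i => if i < k then q i else r (i - k), fun i hi => ?_⟩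
    by_cases hik : i < k
    · obtain ⟨h1, h2, h3⟩ := hq i hik
      rw [hf1 i hik]
      refine ⟨fun j hj => ?_, ?_⟩
      · rw [hf1 j (by omega)]
        exact h2 j hj
      · rcases Nat.eq_zero_or_pos i with rfl | h0
        · simp
        · obtain ⟨j, hj, h⟩ := h3 h0
          refine .inr ⟨j, hj, ?_, ?_⟩
          · rw [Nat.div_eq_of_lt hik, Nat.div_eq_of_lt (by omega)]
          · rwa [hf1 j (by omega)]
    · obtain ⟨h1, h2, h3⟩ := hr (i - k) (by omega)
      rw [hf2 i hik]
      refine ⟨fun j hj => ?_, ?_⟩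
      · by_cases hjk : j < k
        · rw [hf1 j hjk]
          exact fun h => Set.disjoint_left.1 hST (hq j hjk).1 (h ▸ h1)
        · rw [hf2 j hjk]
          exact h2 (j - k) (by omega)
      · rcases Nat.eq_zero_or_pos (i - k) with h0 | h0
        · have : i = k := by omega
          simp [this]
        · obtain ⟨j, hj, h⟩ := h3 h0
          have hdiv : ∀ a, k ≤ a → a < 2 * k → a / k = 1 := fun a h h' =>
            Nat.div_eq_of_lt_le (by omega) (by omega)
          refine .inr ⟨j + k, by omega, ?_, ?_⟩
          · rw [hdiv i (by omega) hi, hdiv (j + k) (by omega) (by omega)]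
          · rwa [hf2 (j + k) (by omega), Nat.add_sub_cancel]
  · rintro ⟨f, hf⟩
    have hinj : ∀ i < 2 * k, ∀ j < 2 * k, f i = f j → i = j := fun i hi j hj h => by
      rcases lt_trichotomy i j with hij | hij | hij
      · exact ((hf j hj).1 i hij h).elim
      · exact hij
      · exact ((hf i hi).1 j hij h.symm).elim
    refine ⟨f '' Set.Iio k, (fun i => f (k + i)) '' Set.Iio k, ?_, ?_, ?_, ?_, ?_⟩
    · rw [Set.disjoint_left]
      rintro _ ⟨i, hi, rfl⟩ ⟨j, hj, h⟩
      simp only [Set.mem_Iio] at hi hj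
      have := hinj _ (by omega) _ (by omega) h
      omega
    · refine CutConnected.image_prefix fun i hi h0 => ?_
      rcases (hf i (by omega)).2 with h | ⟨j, hj, -, h⟩
      · rw [Nat.mod_eq_of_lt hi] at h
        omega
      · exact ⟨j, hj, h⟩
    · refine CutConnected.image_prefix fun i hi h0 => ?_
      rcases (hf (k + i) (by omega)).2 with h | ⟨j, hj, hdiv, h⟩
      · rw [Nat.add_mod_left, Nat.mod_eq_of_lt hi] at h
        omega
      -- Equality of the quotients by `k` keeps the earlier neighbour in the second block.
      · have hkj : k ≤ j := by
          by_contra! hlt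
          rw [Nat.div_eq_of_lt hlt, Nat.add_div_left _ hk] at hdiv
          exact absurd hdiv.symm (Nat.succ_ne_zero _)
        exact ⟨j - k, by omega, by rwa [Nat.add_sub_cancel' hkj]⟩
    · rw [Set.InjOn.ncard_image, Set.ncard_Iio_nat]
      intro i hi j hj h
      simp only [Set.mem_Iio] at hi hj
      exact hinj i (by omega) j (by omega) h
    · rw [Set.InjOn.ncard_image, Set.ncard_Iio_nat]
      intro i hi j hj h
      simp only [Set.mem_Iio] at hi hj
      have := hinj _ (by omega) _ (by omega) h
      omega

end Sequences

/-! ## Large graphs -/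

section Sweep

variable {n k : ℕ} {G : SimpleGraph (Fin n)} {E : ℕ → ℕ → Prop} {X : ℕ → Prop} {s : ℕ}
  {vis q p : ℕ → ℕ} {t : ℕ}

/-- All connected sets of vertices with property `X` that do not contain `c` have less than `k`
vertices. -/
def NoLargeSet (G : SimpleGraph (Fin n)) (k : ℕ) (c : Fin n) (X : ℕ → Prop) : Prop :=
  ∀ D : Set (Fin n), CutConnected G D → c ∉ D → (∀ v ∈ D, X v) → D.ncard < k

namespace SearchInv

theorem exists_fin (H : SearchInv n E X s vis q p t t) : ∃ r : ℕ → Fin n, ∀ i < t, r i = q i := by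
  have h0 := H.lt 0 H.pos
  refine ⟨fun i => if h : q i < n then ⟨q i, h⟩ else ⟨q 0, h0⟩, fun i hi => ?_⟩
  simp only [dif_pos (H.lt i hi)]

theorem injOn_fin (H : SearchInv n E X s vis q p t t) {r : ℕ → Fin n}
    (hr : ∀ i < t, r i = q i) : Set.InjOn r (Set.Iio t) := by
  intro i hi j hj h
  have hi' := hr i hi
  have hj' := hr j hj
  rw [h] at hi'
  rcases lt_trichotomy i j with hij | hij | hij
  · exact (H.inj j hj i hij (hi'.symm.trans hj')).elim
  · exact hij
  · exact (H.inj i hi j hij (hj'.symm.trans hi')).elim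

theorem adj_fin (H : SearchInv n E X s vis q p t t) (hE : ∀ u v : Fin n, E u v ↔ G.Adj u v)
    {r : ℕ → Fin n} (hr : ∀ i < t, r i = q i) :
    ∀ i < t, 0 < i → p i < i ∧ G.Adj (r (p i)) (r i) := by
  intro i hi h0
  obtain ⟨h1, h2⟩ := H.parent i hi h0
  rw [← hr i hi, ← hr (p i) (by omega)] at h2
  exact ⟨h1, (hE _ _).1 h2⟩

theorem cutConnected_fin (H : SearchInv n E X s vis q p t t)
    (hE : ∀ u v : Fin n, E u v ↔ G.Adj u v) {r : ℕ → Fin n} (hr : ∀ i < t, r i = q i) :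
    CutConnected G (r '' Set.Iio t) :=
  CutConnected.image_prefix fun i hi h0 => ⟨p i, H.adj_fin hE hr i hi h0⟩

theorem ncard_fin (H : SearchInv n E X s vis q p t t) {r : ℕ → Fin n}
    (hr : ∀ i < t, r i = q i) : (r '' Set.Iio t).ncard = t := by
  rw [(H.injOn_fin hr).ncard_image, Set.ncard_Iio_nat]

/-- In a connected graph an edge would leave the set of vertices found, whereas a finished search is
closed under neighbours. -/
theorem exists_of_connected (H : SearchInv n E X s vis q p t t) (hG : G.Connected)
    (hE : ∀ u v : Fin n, E u v ↔ G.Adj u v) (hX : ∀ v, ¬ X v) {r : ℕ → Fin n}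
    (hr : ∀ i < t, r i = q i) (v : Fin n) : ∃ i < t, r i = v := by
  by_contra hv
  obtain ⟨u, ⟨i, hi, rfl⟩, w, hw, hadj⟩ := (hG.preconnected (r 0) v).exists_adj_boundary
    (A := r '' Set.Iio t) ⟨0, H.pos, rfl⟩ hv
  have hEw : E (q i) w := by
    rw [← hr i hi]
    exact (hE _ _).2 hadj
  rcases (H.vis_iff w w.2).1 (H.closed i hi w w.2 hEw) with h | ⟨j, hj, h⟩
  · exact hX _ h
  · exact hw ⟨j, hj, Fin.ext ((hr j hj).trans h)⟩

/-- A connected set that avoids `c` cannot meet both the old visited set and the new component: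
`hclosed` would put a newly found vertex into `X`. So it lies in one of the two, and the new
component has only `t < k` vertices. -/
theorem noLargeSet (H : SearchInv n E X s vis q p t t) {c : Fin n} (hclosed : ∀ u v : Fin n, X u → u ≠ c → G.Adj u v → X v)
    (hX : NoLargeSet G k c X) (ht : t < k) : NoLargeSet G k c fun v => vis v ≠ 0 := by
  obtain ⟨r, hr⟩ := H.exists_fin
  intro D hD hcD hvis
  have hmem : ∀ v ∈ D, X v ∨ v ∈ r '' Set.Iio t := fun v hv => by
    rcases (H.vis_iff v v.2).1 (hvis v hv) with h | ⟨i, hi, h⟩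
    · exact .inl h
    · exact .inr ⟨i, hi, Fin.ext ((hr i hi).trans h)⟩
  by_cases h1 : ∃ v ∈ D, v ∈ r '' Set.Iio t
  · by_cases h2 : ∃ v ∈ D, v ∉ r '' Set.Iio t
    · obtain ⟨u, hu, ⟨i, hi, rfl⟩, v, hv, hvC, hadj⟩ := hD _ h1 h2
      have hXv := (hmem v hv).resolve_right hvC
      have := hclosed v (r i) hXv (fun h => hcD (h ▸ hv)) hadj.symm
      rw [hr i hi] at this
      exact (H.notMem i hi this).elim
    · push Not at h2
      have := Set.ncard_le_ncard (show D ⊆ r '' Set.Iio t from h2)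
      rw [H.ncard_fin hr] at this
      omega
  · push Not at h1
    exact hX D hD hcD fun v hv => (hmem v hv).resolve_right (h1 v hv)

/-- The amortization: the vertices found by a search are new, so the costs of all searches add up to
`O(n)` per visited vertex. -/
theorem card_vis (H : SearchInv n E X s vis q p t t) {vis₀ : ℕ → ℕ}
    (hX : ∀ v < n, vis₀ v ≠ 0 → X v) :
    ((Finset.range n).filter fun v => vis₀ v ≠ 0).card + t ≤
      ((Finset.range n).filter fun v => vis v ≠ 0).card := by
  conv_lhs => rw [← H.card_image]
  rw [← Finset.card_union_of_disjoint]
  · refine Finset.card_le_card fun v hv => ?_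
    simp only [Finset.mem_union, Finset.mem_filter, Finset.mem_range, Finset.mem_image] at hv ⊢
    rcases hv with ⟨hv, h⟩ | ⟨i, hi, rfl⟩
    · exact ⟨hv, (H.vis_iff v hv).2 (.inl (hX v hv h))⟩
    · exact ⟨H.lt i hi, (H.vis_iff _ (H.lt i hi)).2 (.inr ⟨i, hi, rfl⟩)⟩
  · rw [Finset.disjoint_left]
    intro v hv hv'
    simp only [Finset.mem_filter, Finset.mem_range, Finset.mem_image] at hv hv'
    obtain ⟨i, hi, rfl⟩ := hv'
    exact H.notMem i hi (hX _ hv.1 hv.2)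

end SearchInv

end Sweep

/-- The registers and memory cells that hold the input and the result. -/
structure Base (n k : ℕ) (m₀ : ℕ → ℕ) (r₀ : ℕ) (s : RamState) : Prop where
  r₀ : s.reg 0 = r₀
  r₁ : s.reg 1 = n
  r₂ : s.reg 2 = k
  r₃ : s.reg 3 = 2 + n * n
  low : ∀ a < 2 + n * n, s.mem a = m₀ a

namespace Base

variable {n k : ℕ} {m₀ : ℕ → ℕ} {r₀ : ℕ} {s : RamState}

theorem assign (H : Base n k m₀ r₀ s) {x : ℕ} (v : ℕ) (hx : 3 < x) :
    Base n k m₀ r₀ ⟨Function.update s.reg x v, s.mem⟩ := by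
  obtain ⟨h0, h1, h2, h3, hl⟩ := H
  constructor <;> first | assumption | (dsimp only; rwa [Function.update_of_ne (by omega)])

theorem store (H : Base n k m₀ r₀ s) {a : ℕ} (v : ℕ) (ha : 2 + n * n ≤ a) :
    Base n k m₀ r₀ ⟨s.reg, Function.update s.mem a v⟩ := by
  obtain ⟨h0, h1, h2, h3, hl⟩ := H
  refine ⟨h0, h1, h2, h3, fun a ha => ?_⟩
  dsimp only
  rw [Function.update_of_ne (by omega), hl a ha]

theorem frame (H : Base n k m₀ r₀ s) :
    Frame n k m₀ r₀ (s.reg 8) (s.reg 9) (cell (2 + n * n) 3 s.mem) s :=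
  ⟨H.r₀, H.r₁, H.r₂, H.r₃, rfl, rfl, H.low, rfl⟩

end Base

theorem Frame.base {n k : ℕ} {m₀ : ℕ → ℕ} {r₀ r₈ r₉ : ℕ} {z : ℕ → ℕ} {s : RamState}
    (H : Frame n k m₀ r₀ r₈ r₉ z s) : Base n k m₀ r₀ s :=
  ⟨H.r₀, H.r₁, H.r₂, H.r₃, H.low⟩

/-! ### Programs for large graphs: the center and the sweep around it -/

section
open RamExpr RamProgram

/-- Merge the subtree of the vertex with the index in register `8` into its parent. -/
def mergeProgram : RamProgram :=
  store (cellAddr 3 (load (cellAddr 2 (reg 8))))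
    (load (cellAddr 3 (load (cellAddr 2 (reg 8)))) + (load (cellAddr 3 (reg 8)) + 1)) ;;
  assign 8 (reg 8 - 1)

/-- Compute subtree sizes until some subtree has at least `k` vertices. -/
def centerProgram : RamProgram :=
  assign 8 (reg 1 - 1) ;; loop (reg 2 - (load (cellAddr 3 (reg 8)) + 1)) mergeProgram

/-- Mark the vertex in register `8` as visited and all other vertices as not visited. -/
def clearProgram : RamProgram :=
  assign 7 0 ;;
  loop (reg 1 - reg 7) (store (cellAddr 0 (reg 7)) 0 ;; assign 7 (reg 7 + 1)) ;;
  store (cellAddr 0 (reg 8)) 1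

/-- Search from the vertex in register `9`, unless it has been visited, and record in register
`0` whether at least `k` vertices are found. -/
def sweepStepProgram : RamProgram :=
  cond (load (cellAddr 0 (reg 9))) skip
    (searchProgram ;; cond (reg 2 - reg 5) skip (assign 0 1)) ;; assign 9 (reg 9 + 1)

/-- Search from all vertices. -/
def sweepProgram : RamProgram :=
  assign 9 0 ;; loop (reg 1 - reg 9) sweepStepProgram

/-- The program for graphs with at least `3 * k - 2` vertices. -/
def largeProgram : RamProgram :=
  searchProgram ;; centerProgram ;; assign 8 (load (cellAddr 1 (reg 8))) ;; clearProgram ;;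
  sweepProgram

variable {B n k : ℕ} {m₀ : ℕ → ℕ} {G : SimpleGraph (Fin n)}

theorem MergeInv.size_le {V : Type*} {G : SimpleGraph V} {q : ℕ → V} {z : ℕ → ℕ} {i : ℕ}
    {L M : ℕ → ℕ} (H : MergeInv G q n k z i L M) {r : ℕ} (hr : r ≤ i) : z r + 1 ≤ n := by
  rw [H.size r hr]
  exact (Finset.card_filter_le _ _).trans_eq (Finset.card_range n)

/-- Once everything is merged into the root, its subtree has `n` vertices. Since `k ≤ n`, the search
for a center stops there at the latest. -/
theorem MergeInv.size_zero {V : Type*} {G : SimpleGraph V} {q : ℕ → V} {z : ℕ → ℕ}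
    {L M : ℕ → ℕ} (H : MergeInv G q n k z 0 L M) : z 0 + 1 = n := by
  rw [H.size 0 le_rfl, Finset.filter_true_of_mem, Finset.card_range]
  intro x hx
  have := H.label_le x (Finset.mem_range.1 hx)
  omega

theorem center_runs (hI : IsInput B n k m₀) (hkn : k ≤ n) {s : RamState} {r₀ : ℕ}
    (H : Base n k m₀ r₀ s) {r : ℕ → Fin n}
    (hp : ∀ i < n, 0 < i → cell (2 + n * n) 2 s.mem i < i ∧
      G.Adj (r (cell (2 + n * n) 2 s.mem i)) (r i))
    (hz : cell (2 + n * n) 3 s.mem = fun _ => 0) :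
    Runs B centerProgram s fun t s' => t ≤ 100 * n ∧ Base n k m₀ r₀ s' ∧
      cell (2 + n * n) 1 s'.mem = cell (2 + n * n) 1 s.mem ∧
      k ≤ cell (2 + n * n) 3 s'.mem (s'.reg 8) + 1 ∧
      ∃ L M, MergeInv G r n k (cell (2 + n * n) 3 s'.mem) (s'.reg 8) L M := by
  have hB := hI.bound
  have hn := hI.pos
  -- The loop counts down, so the bound charges 70 steps for each index already passed.
  let I : ℕ → RamState → Prop := fun t s' => t + 70 * s'.reg 8 ≤ 70 * (n - 1) ∧
    Base n k m₀ r₀ s' ∧ cell (2 + n * n) 1 s'.mem = cell (2 + n * n) 1 s.mem ∧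
    cell (2 + n * n) 2 s'.mem = cell (2 + n * n) 2 s.mem ∧
    ∃ L M, MergeInv G r n k (cell (2 + n * n) 3 s'.mem) (s'.reg 8) L M
  have hmem : ∀ (m : ℕ → ℕ) (j i : ℕ), m (2 + n * n + 4 * i + j) = cell (2 + n * n) j m i :=
    fun _ _ _ => rfl
  refine Runs.seq (R := fun t s' => t ≤ 4 ∧ I 0 s') (Runs.of_wp ?_) fun t s₁ h₁ => ?_
  · simp only [Wp, fits_sub, fits_ofNat, fits_reg, eval_sub, eval_ofNat, eval_reg, H.r₁]
    refine ⟨⟨by omega, by omega, by omega⟩, fun t ht => ⟨?_, by simp, H.assign _ (by norm_num),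
      rfl, rfl, id, id, ?_⟩⟩
    · simpa [maxCost] using ht
    · simpa [hz] using MergeInv.init hn
  refine Runs.loop I (fun s' => s'.reg 8) ?_ ?_ ?_ h₁.2
  · rintro t s' ⟨-, H', -, -, L, M, HM⟩
    have h1 := HM.lt
    have h2 := HM.size_le le_rfl
    simp only [fits_sub, fits_reg, fits_add, fits_load, fits_cellAddr (show 4 ≤ B by omega),
      fits_ofNat, eval_add, eval_load, eval_cellAddr, eval_reg, eval_ofNat, H'.r₂, H'.r₃, hmem]
    refine ⟨by omega, ⟨⟨⟨by omega, by omega⟩, by omega⟩, by omega, by omega⟩, by omega⟩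
  · rintro t s' ⟨ht, H', hq, -, L, M, HM⟩ h0
    simp only [eval_sub, eval_reg, eval_add, eval_load, eval_cellAddr, eval_ofNat, H'.r₂, H'.r₃,
      hmem] at h0
    have h₁' := h₁.1
    refine ⟨?_, H', hq, by omega, L, M, HM⟩
    simp only [cost_sub, cost_reg, cost_add, cost_load, cost_cellAddr, cost_ofNat]
    omega
  · rintro t s' ⟨ht, H', hq, hpp, L, M, HM⟩ h0
    simp only [eval_sub, eval_reg, eval_add, eval_load, eval_cellAddr, eval_ofNat, H'.r₂, H'.r₃,
      hmem] at h0
    have h1 := HM.lt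
    have hz1 : cell (2 + n * n) 3 s'.mem (s'.reg 8) + 1 < k := by omega
    have hpos : 0 < s'.reg 8 := by
      rcases Nat.eq_zero_or_pos (s'.reg 8) with h | h
      · rw [h] at HM hz1
        have := HM.size_zero
        omega
      · exact h
    obtain ⟨hp1, hp2⟩ := hp _ h1 hpos
    rw [← hpp] at hp1 hp2
    have HM' := HM.merge (p := cell (2 + n * n) 2 s'.mem) hpos hp1 hp2 hz1
    -- The sum to be stored is the size of a subtree minus one, so it fits into a word.
    have h2 := HM'.size_le (r := cell (2 + n * n) 2 s'.mem (s'.reg 8)) (by omega)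
    have h3 := HM.size_le le_rfl
    rw [Function.update_self] at h2
    refine Runs.of_wp ?_
    simp only [mergeProgram, Wp, fits_sub, fits_reg, fits_add, fits_load, fits_cellAddr (show 4 ≤ B by omega),
      fits_ofNat, eval_add, eval_sub, eval_load, eval_cellAddr, eval_reg, eval_ofNat, H'.r₃, hmem]
    refine ⟨⟨⟨⟨by omega, by omega⟩, by omega⟩, by omega⟩,
      ⟨⟨⟨⟨⟨by omega, by omega⟩, by omega⟩, by omega⟩, by omega⟩,
        ⟨⟨⟨by omega, by omega⟩, by omega⟩, by omega, by omega⟩, by omega⟩,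
      ⟨by omega, by omega, by omega⟩, fun t' ht' => ⟨⟨?_, ?_, ?_, ?_, ?_⟩, ?_⟩⟩
    · simp [maxCost] at ht'
      simp
      omega
    · exact (H'.store _ (by omega)).assign _ (by norm_num)
    · rw [cell_update_of_ne _ _ _ (by norm_num) (by norm_num) (by norm_num), hq]
    · rw [cell_update_of_ne _ _ _ (by norm_num) (by norm_num) (by norm_num), hpp]
    · simp only [cell_update_self, Function.update_self]
      exact ⟨_, _, HM'⟩
    · simp
      omega

theorem clear_runs (hI : IsInput B n k m₀) {s : RamState} {r₀ : ℕ} (H : Base n k m₀ r₀ s)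
    (h8 : s.reg 8 < n) :
    Runs B clearProgram s fun t s' => t ≤ 50 * n ∧ Base n k m₀ r₀ s' ∧ s'.reg 8 = s.reg 8 ∧
      ∀ v < n, cell (2 + n * n) 0 s'.mem v = if v = s.reg 8 then 1 else 0 := by
  have hB := hI.bound
  have hn := hI.pos
  let I : ℕ → RamState → Prop := fun t s' => t ≤ 20 * s'.reg 7 ∧ s'.reg 7 ≤ n ∧
    Base n k m₀ r₀ s' ∧ s'.reg 8 = s.reg 8 ∧ ∀ v < s'.reg 7, cell (2 + n * n) 0 s'.mem v = 0
  refine Runs.seq (R := fun t s' => t ≤ 2 ∧ I 0 s') (Runs.of_wp ?_) fun t s₁ h₁ => ?_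
  · simp only [Wp, fits_ofNat, eval_ofNat]
    refine ⟨by omega, fun t ht => ⟨?_, by simp, by simp, H.assign _ (by norm_num), by simp,
      by simp⟩⟩
    simpa [maxCost] using ht
  refine Runs.seq (R := fun t s' => t ≤ 20 * n + 4 ∧ Base n k m₀ r₀ s' ∧
    s'.reg 8 = s.reg 8 ∧ ∀ v < n, cell (2 + n * n) 0 s'.mem v = 0)
    (Runs.loop I (fun s' => n - s'.reg 7) ?_ ?_ ?_ h₁.2) fun t₂ s₂ h₂ => ?_
  · rintro t s' ⟨-, h7, H', -⟩
    simp only [fits_sub, fits_reg, eval_reg, H'.r₁]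
    omega
  · rintro t s' ⟨ht, h7, H', h8', hv⟩ h0
    simp only [eval_sub, eval_reg, H'.r₁] at h0
    refine ⟨?_, H', h8', fun v hvn => hv v (by omega)⟩
    simp only [cost_sub, cost_reg]
    omega
  · rintro t s' ⟨ht, h7, H', h8', hv⟩ h0
    simp only [eval_sub, eval_reg, H'.r₁] at h0
    refine Runs.of_wp ?_
    simp only [Wp, fits_reg, fits_add, fits_cellAddr (show 4 ≤ B by omega), fits_ofNat, eval_add,
      eval_cellAddr, eval_reg, eval_ofNat, H'.r₃]
    refine ⟨⟨by omega, by omega⟩, by omega, ⟨by omega, by omega, by omega⟩,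
      fun t' ht' => ⟨⟨?_, ?_, (H'.store _ (by omega)).assign _ (by norm_num), ?_, ?_⟩, ?_⟩⟩
    · simp [maxCost] at ht' ⊢
      omega
    · simp
      omega
    · simpa using h8'
    · intro v hlt
      simp only [Function.update_self] at hlt
      simp only [cell_update_self, Function.update_apply]
      split_ifs with h
      · rfl
      · exact hv v (by omega)
    · simp
      omega
  obtain ⟨ht₂, H₂, h8₂, hv⟩ := h₂
  refine Runs.of_wp ?_
  simp only [Wp, fits_reg, fits_cellAddr (show 4 ≤ B by omega), fits_ofNat,
    eval_cellAddr, eval_reg, eval_ofNat, H₂.r₃]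
  refine ⟨⟨by omega, by omega⟩, by omega, fun t' ht' => ⟨?_, H₂.store _ (by omega), h8₂, ?_⟩⟩
  · have := h₁.1
    simp [maxCost] at ht'
    omega
  · intro v hlt
    simp only [cell_update_self, Function.update_apply, h8₂]
    split_ifs with h
    · rfl
    · exact hv v hlt

/-- The invariant of the sweep over all vertices: the visited vertices are `c` and some
components of `G - c`, and `res` tells whether a large one is among them. -/
structure SweepInv (G : SimpleGraph (Fin n)) (k : ℕ) (c : Fin n) (vis : ℕ → ℕ) (res : ℕ) :
    Prop where
  vis_le : ∀ v < n, vis v ≤ 1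
  center : vis c ≠ 0
  closed : ∀ u v : Fin n, vis u ≠ 0 → u ≠ c → G.Adj u v → vis v ≠ 0
  result : (res = 1 ∧ ∃ D : Set (Fin n), CutConnected G D ∧ c ∉ D ∧ k ≤ D.ncard) ∨
    (res = 0 ∧ NoLargeSet G k c fun v => vis v ≠ 0)

/-- The search started outside the visited set, so the set it finds avoids `c`. Either this set is
itself a large witness, or `noLargeSet` extends the negative answer to it. -/
theorem SweepInv.search {c : Fin n} {vis vis' q p : ℕ → ℕ} {res t s : ℕ} {E : ℕ → ℕ → Prop}
    (H : SweepInv G k c vis res) (hE : ∀ u v : Fin n, E u v ↔ G.Adj u v)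
    (HS : SearchInv n E (fun v => vis v ≠ 0) s vis' q p t t) :
    SweepInv G k c vis' (if k - t = 0 then 1 else res) := by
  obtain ⟨r, hr⟩ := HS.exists_fin
  refine ⟨HS.vis_le, (HS.vis_iff c c.2).2 (.inl H.center), ?_, ?_⟩
  · intro u v hu huc huv
    rcases (HS.vis_iff u u.2).1 hu with h | ⟨i, hi, h⟩
    · exact (HS.vis_iff v v.2).2 (.inl (H.closed u v h huc huv))
    · refine HS.closed i hi v v.2 ?_
      rw [h]
      exact (hE u v).2 huv
  · split_ifs with hk
    · refine .inl ⟨rfl, r '' Set.Iio t, HS.cutConnected_fin hE hr, ?_, ?_⟩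
      · rintro ⟨i, hi, h⟩
        refine HS.notMem i hi ?_
        rw [← hr i hi, h]
        exact H.center
      · rw [HS.ncard_fin hr]
        omega
    · rcases H.result with h | ⟨h, h'⟩
      · exact .inl h
      · exact .inr ⟨h, HS.noLargeSet H.closed h' (by omega)⟩

theorem sweepStep_runs (hI : IsInput B n k m₀)
    (hE : ∀ u v : Fin n, MemAdj n m₀ u v ↔ G.Adj u v) {s : RamState} {c : Fin n}
    (H : Base n k m₀ (s.reg 0) s) (HW : SweepInv G k c (cell (2 + n * n) 0 s.mem) (s.reg 0))
    (h9 : s.reg 9 < n) :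
    Runs B sweepStepProgram s fun t s' =>
      -- The number of visited vertices, weighted by `88 * n`, is a potential that pays for the
      -- search.
      t + 88 * n * ((Finset.range n).filter fun v => cell (2 + n * n) 0 s.mem v ≠ 0).card ≤
        88 * n * ((Finset.range n).filter fun v => cell (2 + n * n) 0 s'.mem v ≠ 0).card + 80 ∧
      Base n k m₀ (s'.reg 0) s' ∧ SweepInv G k c (cell (2 + n * n) 0 s'.mem) (s'.reg 0) ∧
      s'.reg 9 = s.reg 9 + 1 ∧
      (∀ v < n, cell (2 + n * n) 0 s.mem v ≠ 0 → cell (2 + n * n) 0 s'.mem v ≠ 0) ∧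
      cell (2 + n * n) 0 s'.mem (s.reg 9) ≠ 0 := by
  have hB := hI.bound
  have hn := hI.pos
  have hmem : s.mem (2 + n * n + 4 * s.reg 9 + 0) = cell (2 + n * n) 0 s.mem (s.reg 9) := rfl
  have hvis := HW.vis_le _ h9
  refine Runs.seq (R := fun t s' =>
      t + 88 * n * ((Finset.range n).filter fun v => cell (2 + n * n) 0 s.mem v ≠ 0).card ≤
        88 * n * ((Finset.range n).filter fun v => cell (2 + n * n) 0 s'.mem v ≠ 0).card + 70 ∧
      Base n k m₀ (s'.reg 0) s' ∧ SweepInv G k c (cell (2 + n * n) 0 s'.mem) (s'.reg 0) ∧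
      s'.reg 9 = s.reg 9 ∧
      (∀ v < n, cell (2 + n * n) 0 s.mem v ≠ 0 → cell (2 + n * n) 0 s'.mem v ≠ 0) ∧
      cell (2 + n * n) 0 s'.mem (s.reg 9) ≠ 0)
    (Runs.cond ?_ (fun hne => ?_) (fun h0 => ?_)) fun t s₁ h₁ => ?_
  · simp only [fits_reg, fits_load, fits_cellAddr (show 4 ≤ B by omega), eval_cellAddr, eval_reg,
      H.r₃, hmem]
    omega
  · simp only [eval_load, eval_cellAddr, eval_reg, H.r₃, hmem] at hne
    refine ⟨1, s, .skip s, ?_, H, HW, rfl, fun _ _ h => h, hne⟩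
    simp
    omega
  · simp only [eval_load, eval_cellAddr, eval_reg, H.r₃, hmem] at h0
    refine Runs.seq (search_runs hI H.frame HW.vis_le h9 h0) fun t₁ s₁ h₁ => ?_
    obtain ⟨ht₁, HS, h45⟩ := h₁
    have HI := HS.inv
    rw [h45] at HI
    have hW' := HW.search hE HI
    have hcard := HI.card_vis (vis₀ := cell (2 + n * n) 0 s.mem) (fun _ _ h => h)
    have hcard' := Nat.mul_le_mul_left (88 * n) hcard
    rw [mul_add] at hcard'
    have htn := HI.le_n
    have hkeep : ∀ v < n, cell (2 + n * n) 0 s.mem v ≠ 0 → cell (2 + n * n) 0 s₁.mem v ≠ 0 :=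
      fun v hv h => (HI.vis_iff v hv).2 (.inl h)
    have hnew : cell (2 + n * n) 0 s₁.mem (s.reg 9) ≠ 0 :=
      (HI.vis_iff _ h9).2 (.inr ⟨0, HI.pos, HI.first⟩)
    have hb := HS.frame.base
    have hr0 := hb.r₀
    refine Runs.of_wp ⟨?_, fun hne => ?_, fun heq => ?_⟩
    · simp only [fits_sub, fits_reg, eval_reg, hb.r₂]
      omega
    · simp only [eval_sub, eval_reg, hb.r₂] at hne
      rw [if_neg hne, ← hr0] at hW'
      refine fun t ht => ⟨?_, hr0.symm ▸ hb, hW', HS.frame.r₉, hkeep, hnew⟩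
      simp [maxCost] at ht ⊢
      simp at hcard'
      omega
    · simp only [eval_sub, eval_reg, hb.r₂] at heq
      rw [if_pos heq] at hW'
      simp only [Wp, fits_ofNat, eval_ofNat]
      refine ⟨by omega, fun t ht => ⟨?_, ⟨rfl, ?_, ?_, ?_, hb.low⟩, ?_, ?_, hkeep, hnew⟩⟩
      · simp [maxCost] at ht ⊢
        simp at hcard'
        omega
      · simpa using hb.r₁
      · simpa using hb.r₂
      · simpa using hb.r₃
      · simpa using hW'
      · simpa using HS.frame.r₉
  · obtain ⟨ht, H', HW', h9', hkeep, hnew⟩ := h₁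
    refine Runs.of_wp ?_
    simp only [Wp, fits_add, fits_ofNat, fits_reg, eval_add, eval_ofNat, eval_reg]
    refine ⟨by omega, fun t' ht' => ⟨?_, ?_, ?_, by simp [h9'], hkeep, hnew⟩⟩
    · simp [maxCost] at ht'
      omega
    · simpa using H'.assign _ (by norm_num)
    · simpa using HW'

theorem sweep_runs (hI : IsInput B n k m₀)
    (hE : ∀ u v : Fin n, MemAdj n m₀ u v ↔ G.Adj u v) {s : RamState} {c : Fin n}
    (H : Base n k m₀ 0 s) (hvis : ∀ v < n, cell (2 + n * n) 0 s.mem v = if v = c then 1 else 0) :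
    Runs B sweepProgram s fun t s' => t ≤ 88 * n * n + 100 * n ∧
      ((∃ D : Set (Fin n), CutConnected G D ∧ c ∉ D ∧ k ≤ D.ncard) → s'.reg 0 = 1) ∧
      ((¬ ∃ D : Set (Fin n), CutConnected G D ∧ c ∉ D ∧ k ≤ D.ncard) → s'.reg 0 = 0) := by
  have hB := hI.bound
  have hn := hI.pos
  have hvis0 : ∀ v : Fin n, cell (2 + n * n) 0 s.mem v ≠ 0 ↔ v = c := fun v => by
    rw [hvis v v.2]
    simp [Fin.ext_iff]
  let I : ℕ → RamState → Prop := fun t s' =>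
    t ≤ 88 * n * ((Finset.range n).filter fun v => cell (2 + n * n) 0 s'.mem v ≠ 0).card +
      84 * s'.reg 9 ∧ s'.reg 9 ≤ n ∧
    Base n k m₀ (s'.reg 0) s' ∧ SweepInv G k c (cell (2 + n * n) 0 s'.mem) (s'.reg 0) ∧
    ∀ v < s'.reg 9, cell (2 + n * n) 0 s'.mem v ≠ 0
  refine Runs.seq (R := fun t s' => t ≤ 2 ∧ I 0 s') (Runs.of_wp ?_) fun t s₁ h₁ => ?_
  · simp only [Wp, fits_ofNat, eval_ofNat]
    refine ⟨by omega, fun t ht => ⟨?_, by simp, by simp, ?_, ⟨?_, ?_, ?_, .inr ⟨?_, ?_⟩⟩,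
      by simp⟩⟩
    · simpa [maxCost] using ht
    · simpa [H.r₀] using H.assign _ (by norm_num)
    · intro v hv
      dsimp only
      rw [hvis v hv]
      split_ifs <;> norm_num
    · exact (hvis0 c).2 rfl
    · intro u v hu huc
      exact (huc ((hvis0 u).1 hu)).elim
    · simpa using H.r₀
    -- Only `c` is marked at the start, so `D` is empty, and `0 < k` gives the claim.
    · intro D _ hcD hD
      have : D = ∅ := Set.eq_empty_of_forall_notMem fun v hv =>
        hcD ((hvis0 v).1 (hD v hv) ▸ hv)
      rw [this, Set.ncard_empty]
      exact hI.param_pos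
  refine Runs.loop I (fun s' => n - s'.reg 9) ?_ ?_ ?_ h₁.2
  · rintro t s' ⟨-, h9, H', -⟩
    simp only [fits_sub, fits_reg, eval_reg, H'.r₁]
    omega
  · rintro t s' ⟨ht, h9, H', HW, hall⟩ h0
    simp only [eval_sub, eval_reg, H'.r₁] at h0
    have hcard : ((Finset.range n).filter fun v => cell (2 + n * n) 0 s'.mem v ≠ 0).card ≤ n :=
      (Finset.card_filter_le _ _).trans_eq (Finset.card_range n)
    have hcard' := Nat.mul_le_mul_left (88 * n) hcard
    refine ⟨?_, ?_, ?_⟩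
    · have := h₁.1
      simp only [cost_sub, cost_reg]
      omega
    · rintro ⟨D, hD, hcD, hDk⟩
      rcases HW.result with h | ⟨-, h⟩
      · exact h.1
      · have := h D hD hcD fun v _ => hall v (by omega)
        omega
    · intro hno
      rcases HW.result with h | h
      · exact (hno h.2).elim
      · exact h.1
  · rintro t s' ⟨ht, h9, H', HW, hall⟩ h0
    simp only [eval_sub, eval_reg, H'.r₁] at h0
    refine (sweepStep_runs hI hE H' HW (by omega)).mono ?_
    rintro t' s'' ⟨ht', H'', HW', h9', hkeep, hnew⟩
    refine ⟨⟨?_, by omega, H'', HW', fun v hv => ?_⟩, by omega⟩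
    · simp only [cost_sub, cost_reg]
      omega
    · rcases Nat.lt_succ_iff_lt_or_eq.1 (h9' ▸ hv) with hv | rfl
      · exact hkeep v (by omega) (hall v hv)
      · exact hnew

/-- The first search provides the spanning tree, the merging provides the pivot, and the sweep then
decides the right side of `MergeInv.hasDisjointConnected_iff`. -/
theorem large_runs (hI : IsInput B n k m₀) (hG : G.Connected)
    (hE : ∀ u v : Fin n, MemAdj n m₀ u v ↔ G.Adj u v) (hkn : k ≤ n) (h3k : 3 * k ≤ n + 2)
    {s : RamState} (H : Base n k m₀ 0 s) (h9 : s.reg 9 = 0)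
    (hmem : ∀ a, 2 + n * n ≤ a → s.mem a = 0) :
    Runs B largeProgram s fun t s' => t ≤ 1000 * (n * n) ∧
      (HasDisjointConnected G k → s'.reg 0 = 1) ∧
      (¬ HasDisjointConnected G k → s'.reg 0 = 0) := by
  have hB := hI.bound
  have hn := hI.pos
  have hcell : ∀ j i, cell (2 + n * n) j s.mem i = 0 := fun j i => hmem _ (by omega)
  refine Runs.seq (search_runs hI H.frame (fun v _ => by rw [hcell]; exact Nat.zero_le 1)
    (by omega) (hcell _ _)) fun t₁ s₁ h₁ => ?_
  obtain ⟨ht₁, HS, h45⟩ := h₁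
  have HI := HS.inv
  rw [h45] at HI
  obtain ⟨r, hr⟩ := HI.exists_fin
  have hsurj := HI.exists_of_connected hG hE (fun v h => h (hcell 0 v)) hr
  -- The search reaches every vertex, so its queue order serves as the tree order on all of `0, …, n
  -- - 1`.
  have ht : s₁.reg 5 = n := by
    have h1 := HI.ncard_fin hr
    have : r '' Set.Iio (s₁.reg 5) = Set.univ := Set.eq_univ_of_forall hsurj
    rw [this, Set.ncard_univ, Nat.card_eq_fintype_card, Fintype.card_fin] at h1
    exact h1.symm
  rw [ht] at HI hr hsurj ht₁
  have hp := HI.adj_fin hE hr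
  have hz : cell (2 + n * n) 3 s₁.mem = fun _ => 0 := by
    rw [HS.frame.z]
    funext i
    exact hcell 3 i
  refine Runs.seq (center_runs hI hkn HS.frame.base hp hz) fun t₂ s₂ h₂ => ?_
  obtain ⟨ht₂, H₂, hq, hk, L, M, HM⟩ := h₂
  have hiff := HM.hasDisjointConnected_iff hI.param_pos (Fintype.card_fin n) h3k
    (HI.injOn_fin hr) hsurj hp hk
  rw [hiff]
  have hlt := HM.lt
  have hc : s₂.mem (2 + n * n + 4 * s₂.reg 8 + 1) = r (s₂.reg 8) := by
    rw [hr _ hlt, ← hq]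
    rfl
  have hcn := (r (s₂.reg 8)).2
  refine Runs.seq (R := fun t s' => t ≤ 20 ∧ Base n k m₀ 0 s' ∧ s'.reg 8 = r (s₂.reg 8))
    (Runs.of_wp ?_) fun t₃ s₃ h₃ => ?_
  · simp only [Wp, fits_load, fits_cellAddr (show 4 ≤ B by omega), fits_reg, eval_load,
      eval_cellAddr, eval_reg, H₂.r₃, hc]
    refine ⟨by omega, fun t ht => ⟨?_, H₂.assign _ (by norm_num), by simp⟩⟩
    simp [maxCost] at ht
    omega
  obtain ⟨ht₃, H₃, h8⟩ := h₃
  refine Runs.seq (clear_runs hI H₃ (by omega)) fun t₄ s₄ h₄ => ?_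
  obtain ⟨ht₄, H₄, -, hvis⟩ := h₄
  rw [h8] at hvis
  refine (sweep_runs hI hE H₄ hvis).mono fun t₅ s₅ h₅ => ⟨?_, h₅.2⟩
  have h5 := h₅.1
  have : n ≤ n * n := Nat.le_mul_of_pos_left n hn
  have e : 88 * n * n = 88 * (n * n) := mul_assoc _ _ _
  omega
end

/-! ## Small graphs -/

/-- The number with the digits `d 0, …, d (m - 1)` to the base `n`. -/
def digitValue (n : ℕ) (d : ℕ → ℕ) (m : ℕ) : ℕ := ∑ i ∈ Finset.range m, d i * n ^ i

section Digits

variable {n : ℕ} {d e : ℕ → ℕ} {m : ℕ}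

theorem digitValue_succ : digitValue n d (m + 1) = digitValue n d m + d m * n ^ m :=
  Finset.sum_range_succ _ _

theorem digitValue_lt (h : ∀ i < m, d i < n) : digitValue n d m < n ^ m := by
  induction m with
  | zero => simp [digitValue]
  | succ m ih =>
    have h1 := ih fun i hi => h i (by omega)
    have h2 : (d m + 1) * n ^ m ≤ n * n ^ m := Nat.mul_le_mul_right _ (h m (by omega))
    rw [digitValue_succ, pow_succ, mul_comm (n ^ m)]
    rw [add_mul] at h2
    omega

theorem digitValue_inj (hd : ∀ i < m, d i < n) (he : ∀ i < m, e i < n)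
    (h : digitValue n d m = digitValue n e m) : ∀ i < m, d i = e i := by
  induction m with
  | zero => exact fun i hi => absurd hi (Nat.not_lt_zero i)
  | succ m ih =>
    have h1 := digitValue_lt fun i hi => hd i (Nat.lt_succ_of_lt hi)
    have h2 := digitValue_lt fun i hi => he i (Nat.lt_succ_of_lt hi)
    rw [digitValue_succ, digitValue_succ] at h
    have hpos : 0 < n ^ m := by omega
    have hm : d m = e m := by
      have h3 := congrArg (· / n ^ m) h
      simp only [Nat.add_mul_div_right _ _ hpos, Nat.div_eq_of_lt h1, Nat.div_eq_of_lt h2] at h3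
      omega
    rw [hm] at h
    intro i hi
    rcases Nat.lt_succ_iff_lt_or_eq.1 hi with hi | rfl
    · exact ih (fun i hi => hd i (by omega)) (fun i hi => he i (by omega)) (by omega) i hi
    · exact hm

/-- Stated additively to avoid truncated subtraction. -/
theorem digitValue_update {i x : ℕ} (hi : i < m) :
    digitValue n (Function.update d i x) m + d i * n ^ i = digitValue n d m + x * n ^ i := by
  induction m with
  | zero => omega
  | succ m ih =>
    rw [digitValue_succ, digitValue_succ]
    rcases Nat.lt_succ_iff_lt_or_eq.1 hi with hi | rfl
    · rw [Function.update_of_ne (by omega)]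
      have := ih hi
      omega
    · have : digitValue n (Function.update d i x) i = digitValue n d i :=
        Finset.sum_congr rfl fun j hj => by
          rw [Function.update_of_ne (Finset.mem_range.1 hj).ne]
      rw [this, Function.update_self]
      omega

theorem digitValue_eq_zero (h : ∀ i < m, d i = 0) : digitValue n d m = 0 :=
  Finset.sum_eq_zero fun i hi => by rw [h i (Finset.mem_range.1 hi), zero_mul]

end Digits

/-- The condition on the `i`-th entry in `IsGrowing`. -/
def IsGrowingAt (E : ℕ → ℕ → Prop) (k : ℕ) (d : ℕ → ℕ) (i : ℕ) : Prop :=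
  (∀ j < i, d j ≠ d i) ∧ (i % k = 0 ∨ ∃ j < i, j / k = i / k ∧ E (d j) (d i))

theorem IsGrowing.congr {E : ℕ → ℕ → Prop} {k : ℕ} {d e : ℕ → ℕ} (h : IsGrowing E k d)
    (hde : ∀ i < 2 * k, d i = e i) : IsGrowing E k e := by
  intro i hi
  obtain ⟨h1, h2⟩ := h i hi
  refine ⟨fun j hj => ?_, h2.imp_right ?_⟩
  · rw [← hde i hi, ← hde j (by omega)]
    exact h1 j hj
  · rintro ⟨j, hj, hjk, hE⟩
    rw [hde i hi, hde j (by omega)] at hE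
    exact ⟨j, hj, hjk, hE⟩

theorem exists_isGrowing_fin_iff {n k : ℕ} {G : SimpleGraph (Fin n)} {E : ℕ → ℕ → Prop}
    (hn : 0 < n) (hE : ∀ u v : Fin n, E u v ↔ G.Adj u v) :
    (∃ f : ℕ → Fin n, IsGrowing G.Adj k f) ↔
      ∃ d : ℕ → ℕ, (∀ i < 2 * k, d i < n) ∧ IsGrowing E k d := by
  have key : ∀ f : ℕ → Fin n, IsGrowing G.Adj k f ↔ IsGrowing E k fun i => f i := fun f => by
    refine forall₂_congr fun i _ => and_congr ?_ ?_
    · exact forall₂_congr fun j _ => not_congr Fin.ext_iff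
    · exact or_congr_right (exists_congr fun j => and_congr_right fun _ =>
        and_congr_right fun _ => (hE _ _).symm)
  constructor
  · rintro ⟨f, hf⟩
    exact ⟨fun i => f i, fun i _ => (f i).2, (key f).1 hf⟩
  · rintro ⟨d, hd, h⟩
    refine ⟨fun i => if hi : i < 2 * k then ⟨d i, hd i hi⟩ else ⟨0, hn⟩,
      (key _).2 (h.congr fun i hi => ?_)⟩
    simp only [dif_pos hi]

/-! ### Enumeration of all sequences of `2 * k` vertices -/

section
open RamExpr RamProgram

/-- The digit with index `e` of the sequence that is being examined. -/
def digitExpr (e : RamExpr) : RamExpr := load (reg 3 + e)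

/-- Compare the digits with the indices in the registers `6` and `7`. -/
def pairProgram : RamProgram :=
  -- The sum of both truncated differences vanishes only for equal digits.
  RamProgram.cond (digitExpr (reg 6) - digitExpr (reg 7) + (digitExpr (reg 7) - digitExpr (reg 6))) skip
    (assign 5 0) ;;
  -- As register `7` stays below register `6`, the truncated difference of the quotients is zero
  -- exactly when both indices lie in the same block.
  RamProgram.cond (adjEntry (digitExpr (reg 7)) (digitExpr (reg 6)) *
    (1 - (reg 6 / reg 2 - reg 7 / reg 2))) (assign 8 1) skip ;;
  assign 7 (reg 7 + 1)

/-- Test the condition of `IsGrowing` for the index in register `6`. -/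
def rowProgram : RamProgram :=
  -- The flag starts at `1` exactly for the first index of a block, which needs no earlier
  -- neighbour.
  assign 8 (1 - (reg 6 - reg 6 / reg 2 * reg 2)) ;; assign 7 0 ;;
  loop (reg 6 - reg 7) pairProgram ;; cond (reg 8) skip (assign 5 0) ;; assign 6 (reg 6 + 1)

/-- Test the condition of `IsGrowing` and leave the answer in register `5`. -/
def checkProgram : RamProgram :=
  assign 5 1 ;; assign 6 0 ;; loop (2 * reg 2 - reg 6) rowProgram

/-- Replace the last digits by zeros as long as they are maximal. -/
def carryProgram : RamProgram :=
  -- The factors test that the index is in range and that its digit equals `n - 1`.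
  loop ((2 * reg 2 - reg 6) * (1 - (reg 1 - 1 - digitExpr (reg 6))))
    (store (reg 3 + reg 6) 0 ;; assign 6 (reg 6 + 1))

/-- Pass to the next sequence, or set register `4` if there is none. -/
def nextProgram : RamProgram :=
  assign 6 0 ;; carryProgram ;;
  RamProgram.cond (2 * reg 2 - reg 6) (store (reg 3 + reg 6) (digitExpr (reg 6) + 1)) (assign 4 1)

/-- The program that tests all sequences of `2 * k` vertices. -/
def smallProgram : RamProgram :=
  loop (1 - reg 4) (checkProgram ;; cond (reg 5) (assign 0 1 ;; assign 4 1) nextProgram)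

variable {B n k : ℕ} {m₀ : ℕ → ℕ}

/-- The digits stored in the memory `m` behind the input. -/
def memDigits (n : ℕ) (m : ℕ → ℕ) (i : ℕ) : ℕ := m (2 + n * n + i)

theorem memDigits_update (m : ℕ → ℕ) (i x : ℕ) :
    memDigits n (Function.update m (2 + n * n + i) x) =
      Function.update (memDigits n m) i x := by
  funext a
  simp [memDigits, Function.update_apply]

/-- A state with memory `m` during the test of a sequence. -/
structure CheckState (n k : ℕ) (m₀ m : ℕ → ℕ) (s : RamState) : Prop where
  base : Base n k m₀ 0 s
  mem : s.mem = m
  r₄ : s.reg 4 = 0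

theorem CheckState.assign {m : ℕ → ℕ} {s : RamState} (H : CheckState n k m₀ m s) {x : ℕ}
    (v : ℕ) (hx : 4 < x) : CheckState n k m₀ m ⟨Function.update s.reg x v, s.mem⟩ := by
  refine ⟨H.base.assign v (by omega), H.mem, ?_⟩
  dsimp only
  rw [Function.update_of_ne (by omega), H.r₄]

theorem pair_runs (hI : IsInput B n k m₀) {m : ℕ → ℕ} (hm : ∀ i, memDigits n m i < n)
    {s : RamState} (H : CheckState n k m₀ m s) (hi : s.reg 6 < 2 * k) (hj : s.reg 7 < s.reg 6)
    {P Q : Prop} (h5 : s.reg 5 ≤ 1 ∧ (s.reg 5 ≠ 0 ↔ P)) (h8 : s.reg 8 ≤ 1 ∧ (s.reg 8 ≠ 0 ↔ Q)) :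
    Runs B pairProgram s fun t s' => t ≤ 60 ∧ CheckState n k m₀ m s' ∧ s'.reg 6 = s.reg 6 ∧
      s'.reg 7 = s.reg 7 + 1 ∧
      (s'.reg 5 ≤ 1 ∧ (s'.reg 5 ≠ 0 ↔ P ∧ memDigits n m (s.reg 7) ≠ memDigits n m (s.reg 6))) ∧
      (s'.reg 8 ≤ 1 ∧ (s'.reg 8 ≠ 0 ↔ Q ∨ (s.reg 7 / k = s.reg 6 / k ∧
        MemAdj n m₀ (memDigits n m (s.reg 7)) (memDigits n m (s.reg 6))))) := by
  have hB := hI.bound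
  have hdig : ∀ i, s.mem (2 + n * n + i) = memDigits n m i := fun i => by rw [H.mem]; rfl
  have hd6 := hm (s.reg 6)
  have hd7 := hm (s.reg 7)
  have hdiv6 : s.reg 6 / k ≤ s.reg 6 := Nat.div_le_self _ _
  have hdiv7 : s.reg 7 / k ≤ s.reg 7 := Nat.div_le_self _ _
  have hdiv : s.reg 7 / k ≤ s.reg 6 / k := Nat.div_le_div_right hj.le
  have hdiff : s.reg 6 / k - s.reg 7 / k ≤ s.reg 6 := (Nat.sub_le _ _).trans hdiv6
  have hcost : pairProgram.maxCost ≤ 60 := by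
    simp [pairProgram, maxCost, adjEntry, digitExpr]
  have hadj := hI.adj_le _ hd7 _ hd6
  have hmul : m₀ (2 + memDigits n m (s.reg 7) * n + memDigits n m (s.reg 6)) *
      (1 - (s.reg 6 / k - s.reg 7 / k)) ≤ 1 := Nat.mul_le_mul hadj (Nat.sub_le _ _)
  -- Both outcomes of the first test continue with the same code, which is therefore verified once
  -- for an arbitrary intermediate state.
  have hrow : ∀ s₁ : RamState, CheckState n k m₀ m s₁ → s₁.reg 6 = s.reg 6 →
      s₁.reg 7 = s.reg 7 → s₁.reg 8 = s.reg 8 →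
      (s₁.reg 5 ≤ 1 ∧ (s₁.reg 5 ≠ 0 ↔ P ∧
        memDigits n m (s.reg 7) ≠ memDigits n m (s.reg 6))) →
      (RamProgram.cond (adjEntry (digitExpr (reg 7)) (digitExpr (reg 6)) *
        (1 - (reg 6 / reg 2 - reg 7 / reg 2))) (assign 8 1) skip ;;
        assign 7 (reg 7 + 1)).Wp B (fun s' => ∀ t ≤ pairProgram.maxCost,
      t ≤ 60 ∧ CheckState n k m₀ m s' ∧ s'.reg 6 = s.reg 6 ∧
      s'.reg 7 = s.reg 7 + 1 ∧
      (s'.reg 5 ≤ 1 ∧ (s'.reg 5 ≠ 0 ↔ P ∧ memDigits n m (s.reg 7) ≠ memDigits n m (s.reg 6))) ∧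
      (s'.reg 8 ≤ 1 ∧ (s'.reg 8 ≠ 0 ↔ Q ∨ (s.reg 7 / k = s.reg 6 / k ∧
        MemAdj n m₀ (memDigits n m (s.reg 7)) (memDigits n m (s.reg 6)))))) s₁ := by
    intro s₁ H₁ e6 e7 e8 h5
    have hdig₁ : ∀ i, s₁.mem (2 + n * n + i) = memDigits n m i := fun i => by rw [H₁.mem]; rfl
    have hev : ∀ x, (digitExpr (reg x)).eval s₁ = memDigits n m (s₁.reg x) := fun x => by
      simp [digitExpr, H₁.base.r₃, hdig₁]
    have hfit : ∀ x, s₁.reg x < 2 * k → (digitExpr (reg x)).Fits B s₁ := fun x hx => by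
      have := hm (s₁.reg x)
      simp only [digitExpr, fits_load, fits_add, fits_reg, eval_add, eval_reg, H₁.base.r₃, hdig₁]
      omega
    obtain ⟨hf, hval⟩ := fits_adjEntry hI (e := digitExpr (reg 7)) (e' := digitExpr (reg 6))
      H₁.base.r₁ H₁.base.low (hfit 7 (by omega)) (hfit 6 (by omega)) (by rw [hev]; exact hm _)
      (by rw [hev]; exact hm _)
    rw [hev, hev, e6, e7] at hval
    refine ⟨?_, fun hne => ?_, fun heq => ?_⟩
    · simp only [fits_mul, fits_sub, fits_div, fits_ofNat, fits_reg, eval_sub, eval_div, eval_reg,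
        eval_ofNat, hval, e6, e7, H₁.base.r₂]
      exact ⟨hf, ⟨by omega, ⟨⟨by omega, by omega, by omega⟩, ⟨by omega, by omega, by omega⟩,
        by omega⟩, by omega⟩, by omega⟩
    · simp only [eval_mul, eval_sub, eval_div, eval_reg, eval_ofNat, hval, e6, e7,
        H₁.base.r₂] at hne
      have hl := left_ne_zero_of_mul hne
      have hr := right_ne_zero_of_mul hne
      simp only [Wp, fits_ofNat, fits_add, fits_reg, eval_add, eval_reg, eval_ofNat]
      refine ⟨by omega, ?_, fun t ht => ⟨ht.trans hcost,
        (H₁.assign _ (by norm_num)).assign _ (by norm_num), ?_, ?_, ?_, ?_, ?_⟩⟩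
      · simp
        omega
      · simpa using e6
      · simpa using e7
      · simpa using h5
      · simp
      · simp only [ne_eq, Nat.reduceEqDiff, not_false_eq_true,
          Function.update_of_ne, Function.update_self, one_ne_zero, true_iff]
        exact .inr ⟨by omega, hl⟩
    · simp only [eval_mul, eval_sub, eval_div, eval_reg, eval_ofNat, hval, e6, e7,
        H₁.base.r₂] at heq
      simp only [Wp, fits_ofNat, fits_add, fits_reg, eval_add, eval_reg, eval_ofNat]
      refine ⟨by omega, fun t ht => ⟨ht.trans hcost, H₁.assign _ (by norm_num), ?_, ?_, ?_, ?_⟩⟩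
      · simpa using e6
      · simpa using e7
      · simpa using h5
      · have hno : ¬ (s.reg 7 / k = s.reg 6 / k ∧
            MemAdj n m₀ (memDigits n m (s.reg 7)) (memDigits n m (s.reg 6))) := by
          rintro ⟨h1, h2⟩
          rw [h1, Nat.sub_self, Nat.sub_zero, mul_one] at heq
          exact h2 heq
        simpa [e8, hno] using h8
  refine Runs.of_wp ⟨?_, fun hne => ?_, fun heq => ?_⟩
  · simp only [digitExpr, fits_add, fits_sub, fits_load, fits_reg, eval_add, eval_sub, eval_load,
      eval_reg, H.base.r₃, hdig]
    omega
  · simp only [digitExpr, eval_add, eval_sub, eval_load, eval_reg, H.base.r₃, hdig] at hne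
    refine hrow s H rfl rfl rfl ⟨h5.1, ?_⟩
    rw [h5.2]
    exact ⟨fun h => ⟨h, by omega⟩, fun h => h.1⟩
  · simp only [digitExpr, eval_add, eval_sub, eval_load, eval_reg, H.base.r₃, hdig] at heq
    refine ⟨by simp, hrow _ (H.assign _ (by norm_num)) (by simp) (by simp) (by simp) ⟨?_, ?_⟩⟩
    · simp
    · simp
      omega

theorem row_runs (hI : IsInput B n k m₀) {m : ℕ → ℕ} (hm : ∀ i, memDigits n m i < n)
    {s : RamState} (H : CheckState n k m₀ m s) (hi : s.reg 6 < 2 * k)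
    {P : Prop} (h5 : s.reg 5 ≤ 1 ∧ (s.reg 5 ≠ 0 ↔ P)) :
    Runs B rowProgram s fun t s' => t ≤ 170 * k ∧ CheckState n k m₀ m s' ∧
      s'.reg 6 = s.reg 6 + 1 ∧
      (s'.reg 5 ≤ 1 ∧ (s'.reg 5 ≠ 0 ↔
        P ∧ IsGrowingAt (MemAdj n m₀) k (memDigits n m) (s.reg 6))) := by
  have hB := hI.bound
  have hk := hI.param_pos
  set d := memDigits n m with hd
  let I : ℕ → RamState → Prop := fun t s' => t ≤ 64 * s'.reg 7 ∧ s'.reg 7 ≤ s.reg 6 ∧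
    CheckState n k m₀ m s' ∧ s'.reg 6 = s.reg 6 ∧
    (s'.reg 5 ≤ 1 ∧ (s'.reg 5 ≠ 0 ↔ P ∧ ∀ j < s'.reg 7, d j ≠ d (s.reg 6))) ∧
    (s'.reg 8 ≤ 1 ∧ (s'.reg 8 ≠ 0 ↔ s.reg 6 % k = 0 ∨
      ∃ j < s'.reg 7, j / k = s.reg 6 / k ∧ MemAdj n m₀ (d j) (d (s.reg 6))))
  have hdm := Nat.div_mul_le_self (s.reg 6) k
  have hdl := Nat.div_le_self (s.reg 6) k
  have hmod : s.reg 6 % k = s.reg 6 - s.reg 6 / k * k := Nat.mod_eq_sub_div_mul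
  have hpre : Runs B (assign 8 (1 - (reg 6 - reg 6 / reg 2 * reg 2)) ;; assign 7 0) s
      fun t s' => t ≤ 12 ∧ I 0 s' := by
    refine Runs.of_wp ?_
    simp only [Wp, fits_sub, fits_mul, fits_div, fits_ofNat, fits_reg, eval_sub, eval_mul,
      eval_div, eval_reg, eval_ofNat, H.base.r₂]
    refine ⟨by omega, by omega, fun t ht => ⟨?_, by simp, by simp,
      (H.assign _ (by norm_num)).assign _ (by norm_num), by simp, ?_, ?_⟩⟩
    · simpa [maxCost] using ht
    · simpa using h5
    · simp [hmod]
      omega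
  obtain ⟨t₁, s₁, hx₁, ht₁, h₁⟩ := hpre
  have hloop : Runs B (loop (reg 6 - reg 7) pairProgram) s₁ fun t s' => t ≤ 64 * (2 * k) + 4 ∧
      CheckState n k m₀ m s' ∧ s'.reg 6 = s.reg 6 ∧
      (s'.reg 5 ≤ 1 ∧ (s'.reg 5 ≠ 0 ↔ P ∧ ∀ j < s.reg 6, d j ≠ d (s.reg 6))) ∧
      (s'.reg 8 ≤ 1 ∧ (s'.reg 8 ≠ 0 ↔ s.reg 6 % k = 0 ∨
        ∃ j < s.reg 6, j / k = s.reg 6 / k ∧ MemAdj n m₀ (d j) (d (s.reg 6)))) := by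
    refine Runs.loop I (fun s' => s.reg 6 - s'.reg 7) ?_ ?_ ?_ h₁
    · rintro t s' ⟨-, h7, -, h6, -⟩
      simp only [fits_sub, fits_reg, eval_reg]
      omega
    · rintro t s' ⟨ht, h7, H', h6, h5', h8'⟩ h0
      simp only [eval_sub, eval_reg] at h0
      have : s'.reg 7 = s.reg 6 := by omega
      rw [this] at h5' h8'
      refine ⟨?_, H', h6, h5', h8'⟩
      simp only [cost_sub, cost_reg]
      omega
    · rintro t s' ⟨ht, h7, H', h6, h5', h8'⟩ h0
      simp only [eval_sub, eval_reg] at h0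
      refine (pair_runs hI hm H' (by omega) (by omega) h5' h8').mono ?_
      rintro t' s'' ⟨ht', H'', h6'', h7'', h5'', h8''⟩
      refine ⟨⟨?_, by omega, H'', by omega, ⟨h5''.1, ?_⟩, h8''.1, ?_⟩, by omega⟩
      · simp only [cost_sub, cost_reg]
        omega
      · rw [h5''.2, h7'', h6, Nat.forall_lt_succ_right, and_assoc]
      · rw [h8''.2, h7'', h6, Nat.exists_lt_succ_right, or_assoc]
  obtain ⟨t₂, s₂, hx₂, ht₂, H₂, h6₂, h5₂, h8₂⟩ := hloop
  have hpost : Runs B (RamProgram.cond (reg 8) skip (assign 5 0) ;; assign 6 (reg 6 + 1)) s₂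
      fun t s' => t ≤ 10 ∧ CheckState n k m₀ m s' ∧ s'.reg 6 = s.reg 6 + 1 ∧
      (s'.reg 5 ≤ 1 ∧ (s'.reg 5 ≠ 0 ↔ P ∧ IsGrowingAt (MemAdj n m₀) k d (s.reg 6))) := by
    refine Runs.of_wp ⟨?_, fun hne => ?_, fun heq => ?_⟩
    · simp only [fits_reg]
      omega
    · simp only [Wp, fits_add, fits_reg, fits_ofNat, eval_add, eval_reg, eval_ofNat]
      refine ⟨by omega, fun t ht => ⟨?_, H₂.assign _ (by norm_num), ?_, ?_, ?_⟩⟩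
      · simp [maxCost] at ht
        omega
      · simpa using h6₂
      · simpa using h5₂.1
      · have h8 := h8₂.2.1 hne
        simp only [ne_eq, Nat.reduceEqDiff, not_false_eq_true, Function.update_of_ne]
        rw [← ne_eq, h5₂.2]
        exact and_congr_right fun _ => ⟨fun h => ⟨h, h8⟩, fun h => h.1⟩
    · simp only [Wp, fits_add, fits_reg, fits_ofNat, eval_add, eval_reg, eval_ofNat]
      refine ⟨by omega, ?_, fun t ht => ⟨?_, (H₂.assign _ (by norm_num)).assign _ (by norm_num),
        ?_, ?_, ?_⟩⟩
      · simp
        omega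
      · simp [maxCost] at ht
        omega
      · simpa using h6₂
      · simp
      · have h8 := h8₂.2.not.1 (not_not.2 heq)
        simp only [ne_eq, Nat.reduceEqDiff, not_false_eq_true, Function.update_of_ne,
          Function.update_self, not_true_eq_false, false_iff]
        exact fun h => h8 h.2.2
  obtain ⟨t₃, s₃, hx₃, ht₃, h₃⟩ := hpost
  cases hx₁ with
  | seq ha hb =>
    cases hx₃ with
    | seq hc hd =>
      exact ⟨_, _, .seq ha (.seq hb (.seq hx₂ (.seq hc hd))), by omega, h₃⟩

theorem check_runs (hI : IsInput B n k m₀) {m : ℕ → ℕ} (hm : ∀ i, memDigits n m i < n)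
    {s : RamState} (H : CheckState n k m₀ m s) :
    Runs B checkProgram s fun t s' => t ≤ 400 * (k * k) ∧ CheckState n k m₀ m s' ∧
      s'.reg 5 ≤ 1 ∧ (s'.reg 5 ≠ 0 ↔ IsGrowing (MemAdj n m₀) k (memDigits n m)) := by
  have hB := hI.bound
  have hk := hI.param_pos
  let I : ℕ → RamState → Prop := fun t s' => t ≤ (170 * k + 6) * s'.reg 6 ∧ s'.reg 6 ≤ 2 * k ∧
    CheckState n k m₀ m s' ∧ (s'.reg 5 ≤ 1 ∧ (s'.reg 5 ≠ 0 ↔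
      ∀ i < s'.reg 6, IsGrowingAt (MemAdj n m₀) k (memDigits n m) i))
  have hpre : Runs B (assign 5 1 ;; assign 6 0) s fun t s' => t ≤ 4 ∧ I 0 s' := by
    refine Runs.of_wp ?_
    simp only [Wp, fits_ofNat, eval_ofNat]
    refine ⟨by omega, by omega, fun t ht => ⟨?_, by simp, by simp,
      (H.assign _ (by norm_num)).assign _ (by norm_num), by simp, by simp⟩⟩
    simpa [maxCost] using ht
  obtain ⟨t₁, s₁, hx₁, ht₁, h₁⟩ := hpre
  have hloop : Runs B (loop (2 * reg 2 - reg 6) rowProgram) s₁ fun t s' =>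
      t ≤ (170 * k + 6) * (2 * k) + 6 ∧ CheckState n k m₀ m s' ∧
      s'.reg 5 ≤ 1 ∧ (s'.reg 5 ≠ 0 ↔ IsGrowing (MemAdj n m₀) k (memDigits n m)) := by
    refine Runs.loop I (fun s' => 2 * k - s'.reg 6) ?_ ?_ ?_ h₁
    · rintro t s' ⟨-, h6, H', -⟩
      simp only [fits_sub, fits_mul, fits_ofNat, fits_reg, eval_mul, eval_reg, eval_ofNat,
        H'.base.r₂]
      omega
    · rintro t s' ⟨ht, h6, H', h5⟩ h0
      simp only [eval_sub, eval_mul, eval_ofNat, eval_reg, H'.base.r₂] at h0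
      have : s'.reg 6 = 2 * k := by omega
      rw [this] at h5 ht
      refine ⟨?_, H', h5⟩
      simp only [cost_sub, cost_mul, cost_ofNat, cost_reg]
      omega
    · rintro t s' ⟨ht, h6, H', h5⟩ h0
      simp only [eval_sub, eval_mul, eval_ofNat, eval_reg, H'.base.r₂] at h0
      refine (row_runs hI hm H' (by omega) h5).mono ?_
      rintro t' s'' ⟨ht', H'', h6'', h5''⟩
      refine ⟨⟨?_, by omega, H'', h5''.1, ?_⟩, by omega⟩
      · simp only [cost_sub, cost_mul, cost_ofNat, cost_reg, h6'', mul_add]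
        omega
      · rw [h5''.2, h6'', Nat.forall_lt_succ_right]
  obtain ⟨t₂, s₂, hx₂, ht₂, h₂⟩ := hloop
  cases hx₁ with
  | seq ha hb =>
    refine ⟨_, _, .seq ha (.seq hb hx₂), ?_, h₂⟩
    have : k ≤ k * k := Nat.le_mul_of_pos_left k hk
    have e : (170 * k + 6) * (2 * k) = 340 * (k * k) + 12 * k := by ring
    omega

theorem next_runs (hI : IsInput B n k m₀) {s : RamState} (H : Base n k m₀ 0 s)
    (h4 : s.reg 4 = 0) (hm : ∀ i, memDigits n s.mem i < n) :
    Runs B nextProgram s fun t s' => t ≤ 100 * k ∧ Base n k m₀ 0 s' ∧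
      ((s'.reg 4 = 0 ∧ (∀ i, memDigits n s'.mem i < n) ∧
        digitValue n (memDigits n s'.mem) (2 * k) =
          digitValue n (memDigits n s.mem) (2 * k) + 1) ∨
      (s'.reg 4 = 1 ∧ digitValue n (memDigits n s.mem) (2 * k) + 1 = n ^ (2 * k))) := by
  have hB := hI.bound
  have hk := hI.param_pos
  have hn := hI.pos
  set N := digitValue n (memDigits n s.mem) (2 * k) with hN
  -- A carry of weight `n ^ s'.reg 6` is pending: added to the stored number it gives `N + 1`.
  let I : ℕ → RamState → Prop := fun t s' => t ≤ 26 * s'.reg 6 ∧ s'.reg 6 ≤ 2 * k ∧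
    Base n k m₀ 0 s' ∧ s'.reg 4 = 0 ∧ (∀ i, memDigits n s'.mem i < n) ∧
    (∀ i < s'.reg 6, memDigits n s'.mem i = 0) ∧
    digitValue n (memDigits n s'.mem) (2 * k) + n ^ s'.reg 6 = N + 1
  have hdig : ∀ (m : ℕ → ℕ) i, m (2 + n * n + i) = memDigits n m i := fun _ _ => rfl
  refine Runs.seq (R := fun t s' => t ≤ 2 ∧ I 0 s') (Runs.of_wp ?_) fun t₁ s₁ h₁ => ?_
  · simp only [Wp, fits_ofNat, eval_ofNat]
    refine ⟨by omega, fun t ht => ⟨?_, by simp, by simp, H.assign _ (by norm_num), ?_, hm,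
      by simp, by simp [hN]⟩⟩
    · simpa [maxCost] using ht
    · simpa using h4
  refine Runs.seq (R := fun t s' => t ≤ 26 * (2 * k) + 17 ∧ I 0 ⟨s'.reg, s'.mem⟩ ∧
    (s'.reg 6 < 2 * k → memDigits n s'.mem (s'.reg 6) + 1 < n))
    (Runs.loop I (fun s' => 2 * k - s'.reg 6) ?_ ?_ ?_ h₁.2) fun t₂ s₂ h₂ => ?_
  · rintro t s' ⟨-, h6, H', -, hm', -⟩
    have := hm' (s'.reg 6)
    have hmul : (2 * k - s'.reg 6) * (1 - (n - 1 - memDigits n s'.mem (s'.reg 6))) ≤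
      (2 * k) * 1 := Nat.mul_le_mul (Nat.sub_le _ _) (Nat.sub_le _ _)
    simp only [digitExpr, fits_mul, fits_sub, fits_ofNat, fits_reg, fits_load, fits_add, eval_mul,
      eval_sub, eval_add, eval_load, eval_reg, eval_ofNat, H'.r₁, H'.r₂, H'.r₃, hdig]
    refine ⟨by omega, by omega, by omega⟩
  · rintro t s' ⟨ht, h6, h'⟩ h0
    simp only [digitExpr, eval_mul, eval_sub, eval_add, eval_load, eval_reg, eval_ofNat, h'.1.r₁,
      h'.1.r₂, h'.1.r₃, hdig] at h0
    refine ⟨?_, ⟨by simp, h6, h'⟩, fun hlt => ?_⟩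
    · simp only [digitExpr, cost_mul, cost_sub, cost_add, cost_load, cost_ofNat, cost_reg]
      omega
    · rcases mul_eq_zero.1 h0 with h | h <;> omega
  · rintro t s' ⟨ht, h6, H', h4', hm', hz, hval⟩ h0
    simp only [digitExpr, eval_mul, eval_sub, eval_add, eval_load, eval_reg, eval_ofNat, H'.r₁,
      H'.r₂, H'.r₃, hdig] at h0
    have hl := left_ne_zero_of_mul h0
    have hr := right_ne_zero_of_mul h0
    have hlt := hm' (s'.reg 6)
    have hmax : memDigits n s'.mem (s'.reg 6) = n - 1 := by omega
    refine Runs.of_wp ?_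
    simp only [Wp, fits_add, fits_reg, fits_ofNat, eval_add, eval_reg, eval_ofNat, H'.r₃]
    refine ⟨by omega, by omega, by omega, fun t' ht' => ⟨⟨?_, ?_,
      (H'.store _ (by omega)).assign _ (by norm_num), ?_, ?_, ?_, ?_⟩, ?_⟩⟩
    · simp [maxCost, digitExpr] at ht' ⊢
      omega
    · simp
      omega
    · simpa using h4'
    · intro i
      simp only [memDigits_update, Function.update_apply]
      split_ifs
      · exact hn
      · exact hm' i
    · intro i hi
      simp only [Function.update_self] at hi
      simp only [memDigits_update, Function.update_apply]
      split_ifs with h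
      · rfl
      · exact hz i (by omega)
    · simp only [memDigits_update, Function.update_self]
      have hu := digitValue_update (n := n) (d := memDigits n s'.mem) (m := 2 * k)
        (i := s'.reg 6) (x := 0) (by omega)
      have e : n ^ (s'.reg 6 + 1) = (n - 1) * n ^ s'.reg 6 + n ^ s'.reg 6 := by
        rw [pow_succ, mul_comm, ← Nat.succ_mul, Nat.succ_eq_add_one, Nat.sub_add_cancel hn]
      rw [hmax] at hu
      omega
    · simp
      omega
  obtain ⟨ht₂, ⟨-, h6, H₂, h4₂, hm₂, hz, hval⟩, hlt⟩ := h₂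
  simp only at h6 H₂ h4₂ hm₂ hz hval
  have H₂' : Base n k m₀ 0 s₂ := H₂
  have ht₁ := h₁.1
  refine Runs.of_wp ⟨?_, fun hne => ?_, fun heq => ?_⟩
  · simp only [fits_sub, fits_mul, fits_ofNat, fits_reg, eval_mul, eval_reg, eval_ofNat, H₂'.r₂]
    omega
  · simp only [eval_sub, eval_mul, eval_ofNat, eval_reg, H₂'.r₂] at hne
    have hlt' := hlt (by omega)
    simp only [digitExpr, Wp, fits_add, fits_load, fits_reg, fits_ofNat, eval_add, eval_load,
      eval_reg, eval_ofNat, H₂'.r₃, hdig]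
    refine ⟨by omega, by omega, fun t ht => ⟨?_, H₂'.store _ (by omega), .inl ⟨h4₂, ?_, ?_⟩⟩⟩
    · simp [maxCost] at ht
      omega
    · intro i
      simp only [memDigits_update, Function.update_apply]
      split_ifs
      · exact hlt'
      · exact hm₂ i
    · simp only [memDigits_update]
      have hu := digitValue_update (n := n) (d := memDigits n s₂.mem) (m := 2 * k)
        (i := s₂.reg 6) (x := memDigits n s₂.mem (s₂.reg 6) + 1) (by omega)
      rw [add_mul] at hu
      omega
  · simp only [eval_sub, eval_mul, eval_ofNat, eval_reg, H₂'.r₂] at heq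
    -- The carry has run through all digits and left zeros, so `N + 1 = n ^ (2 * k)` and the last
    -- sequence has been passed.
    have h6' : s₂.reg 6 = 2 * k := by omega
    rw [h6'] at hz hval
    rw [digitValue_eq_zero hz] at hval
    simp only [Wp, fits_ofNat, eval_ofNat]
    refine ⟨by omega, fun t ht => ⟨?_, H₂'.assign _ (by norm_num), .inr ⟨by simp, by omega⟩⟩⟩
    simp [maxCost, digitExpr] at ht
    omega

/-- The sequences are visited in the order of their values in base `n`, starting from cleared
memory. The values occur only in the analysis: the machine handles single digits, so no number of
size `n ^ (2 * k)` has to fit into a word. -/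
theorem small_runs (hI : IsInput B n k m₀) {s : RamState} (H : Base n k m₀ 0 s)
    (h4 : s.reg 4 = 0) (hmem : ∀ a, 2 + n * n ≤ a → s.mem a = 0) :
    Runs B smallProgram s fun t s' => t ≤ 600 * (k * k) * n ^ (2 * k) + 4 ∧
      ((∃ d : ℕ → ℕ, (∀ i < 2 * k, d i < n) ∧ IsGrowing (MemAdj n m₀) k d) → s'.reg 0 = 1) ∧
      ((¬ ∃ d : ℕ → ℕ, (∀ i < 2 * k, d i < n) ∧ IsGrowing (MemAdj n m₀) k d) →
        s'.reg 0 = 0) := by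
  have hB := hI.bound
  have hk := hI.param_pos
  have hn := hI.pos
  have hkk : k ≤ k * k := Nat.le_mul_of_pos_left k hk
  -- While register `4` is `0`, all sequences of smaller value have been refuted, at `600 * (k * k)`
  -- steps each; once it is `1`, the answer in register `0` is final.
  let I : ℕ → RamState → Prop := fun t s' =>
    (s'.reg 4 = 0 ∧ Base n k m₀ 0 s' ∧ (∀ i, memDigits n s'.mem i < n) ∧
      t ≤ 600 * (k * k) * digitValue n (memDigits n s'.mem) (2 * k) ∧
      ∀ d : ℕ → ℕ, (∀ i < 2 * k, d i < n) →
        digitValue n d (2 * k) < digitValue n (memDigits n s'.mem) (2 * k) →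
        ¬ IsGrowing (MemAdj n m₀) k d) ∨
    (s'.reg 4 = 1 ∧ t ≤ 600 * (k * k) * n ^ (2 * k) ∧
      ((s'.reg 0 = 1 ∧ ∃ d : ℕ → ℕ, (∀ i < 2 * k, d i < n) ∧ IsGrowing (MemAdj n m₀) k d) ∨
      (s'.reg 0 = 0 ∧ ¬ ∃ d : ℕ → ℕ, (∀ i < 2 * k, d i < n) ∧ IsGrowing (MemAdj n m₀) k d)))
  refine Runs.loop I (fun s' => if s'.reg 4 = 0 then
    n ^ (2 * k) - digitValue n (memDigits n s'.mem) (2 * k) else 0) ?_ ?_ ?_ ?_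
  · rintro t s' (⟨h, -⟩ | ⟨h, -⟩) <;>
    · simp only [fits_sub, fits_ofNat, fits_reg, eval_reg, eval_ofNat, h]
      omega
  · rintro t s' (⟨h, -⟩ | ⟨-, ht, h⟩) h0
    · simp [h] at h0
    · refine ⟨?_, fun he => ?_, fun hne => ?_⟩
      · simp only [cost_sub, cost_ofNat, cost_reg]
        omega
      · exact h.elim (fun h => h.1) fun h => (h.2 he).elim
      · exact h.elim (fun h => (hne h.2).elim) fun h => h.1
  · rintro t s' (⟨h4', H', hm, ht, hno⟩ | ⟨h, -⟩) h0
    swap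
    · simp [h] at h0
    have hlt := digitValue_lt (m := 2 * k) fun i _ => hm i
    set N := digitValue n (memDigits n s'.mem) (2 * k) with hN
    have hmul : 600 * (k * k) * (N + 1) ≤ 600 * (k * k) * n ^ (2 * k) :=
      Nat.mul_le_mul_left _ hlt
    rw [mul_add, mul_one] at hmul
    rw [if_pos h4']
    refine Runs.seq (check_runs hI hm ⟨H', rfl, h4'⟩) fun t₁ s₁ h₁ => ?_
    obtain ⟨ht₁, ⟨H₁, hmem₁, h4₁⟩, h5, hgrow⟩ := h₁
    refine Runs.cond ?_ (fun hne => ?_) (fun heq => ?_)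
    · simp only [fits_reg]
      omega
    · refine Runs.of_wp ?_
      simp only [Wp, fits_ofNat, eval_ofNat]
      refine ⟨by omega, by omega, fun t₂ ht₂ => ⟨.inr ⟨by simp, ?_, .inl ⟨by simp,
        memDigits n s'.mem, fun i _ => hm i, hgrow.1 hne⟩⟩, ?_⟩⟩
      · simp [maxCost] at ht₂ ⊢
        omega
      · simp
        omega
    · have hnot := hgrow.not.1 (not_not.2 heq)
      have hno' : ∀ d : ℕ → ℕ, (∀ i < 2 * k, d i < n) → digitValue n d (2 * k) < N + 1 →
          ¬ IsGrowing (MemAdj n m₀) k d := by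
        intro d hd hdN hg
        rcases Nat.lt_succ_iff_lt_or_eq.1 hdN with h | h
        · exact hno d hd h hg
        · exact hnot (hg.congr (digitValue_inj hd (fun i _ => hm i) h))
      refine (next_runs hI H₁ h4₁ (hmem₁ ▸ hm)).mono ?_
      rw [hmem₁, ← hN]
      rintro t₂ s₂ ⟨ht₂, H₂, ⟨h4₂, hm₂, hval⟩ | ⟨h4₂, hval⟩⟩
      · refine ⟨.inl ⟨h4₂, H₂, hm₂, ?_, hval ▸ hno'⟩, ?_⟩
        · simp only [hval, mul_add, cost_sub, cost_ofNat, cost_reg]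
          omega
        · rw [if_pos h4₂, hval]
          omega
      · refine ⟨.inr ⟨h4₂, ?_, .inr ⟨?_, ?_⟩⟩, ?_⟩
        · simp only [cost_sub, cost_ofNat, cost_reg]
          omega
        · exact H₂.r₀
        · rintro ⟨d, hd, hg⟩
          exact hno' d hd (by rw [hval]; exact digitValue_lt hd) hg
        · rw [if_neg (by omega)]
          omega
  · have hzero : ∀ i, memDigits n s.mem i = 0 := fun i => hmem _ (by omega)
    refine .inl ⟨h4, H, fun i => by rw [hzero]; exact hn, Nat.zero_le _, fun d _ h => ?_⟩
    rw [digitValue_eq_zero fun i _ => hzero i] at h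
    exact absurd h (Nat.not_lt_zero _)
end

/-! ## The algorithm -/

section
open RamExpr RamProgram

/-- The program that decides whether a connected graph is `λ_k`-connected. -/
def lambdaProgram : RamProgram :=
  assign 1 (load 0) ;; assign 2 (load 1) ;; assign 3 (2 + reg 1 * reg 1) ;;
  RamProgram.cond (2 * reg 2 - reg 1) skip
    (RamProgram.cond (3 * reg 2 - (reg 1 + 2)) smallProgram largeProgram)

variable {n k : ℕ} {G : SimpleGraph (Fin n)}

theorem inputState_mem_of_ge {a : ℕ} (ha : 2 + n * n ≤ a) : (inputState G k).mem a = 0 := by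
  simp only [inputState]
  rw [if_neg (by omega), if_neg (by omega), if_neg]
  rintro ⟨i, j, h, -⟩
  have := adj_addr_lt i.2 j.2
  omega

theorem memAdj_inputState (u v : Fin n) : MemAdj n (inputState G k).mem u v ↔ G.Adj u v := by
  simp only [MemAdj, inputState]
  rw [if_neg (by omega), if_neg (by omega)]
  simp only [ne_eq, ite_eq_right_iff, one_ne_zero, imp_false, not_not]
  constructor
  · rintro ⟨i, j, h, hij⟩
    have hn : 0 < n := u.pos
    have h' : (u : ℕ) * n + v = i * n + j := by omega
    have hui : (u : ℕ) = i := by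
      have := congrArg (· / n) h'
      simpa [Nat.add_div_of_dvd_right, Nat.mul_div_cancel _ hn, Nat.div_eq_of_lt] using this
    have huv : (v : ℕ) = j := by
      rw [hui] at h'
      omega
    rwa [Fin.ext hui, Fin.ext huv]
  · exact fun h => ⟨u, v, rfl, h⟩

theorem isInput_inputState (hn : 0 < n) (hk : 0 < k) :
    IsInput ((n + k + 1) ^ 6) n k (inputState G k).mem where
  pos := hn
  param_pos := hk
  bound := by
    -- Since `n` and `k` are positive, four of the six factors contribute at least `81`, and a
    -- quadratic remains to dominate the required bound.
    have h1 : 3 ^ 4 ≤ (n + k + 1) ^ 4 := Nat.pow_le_pow_left (by omega) 4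
    have h2 : 3 ^ 4 * (n + k + 1) ^ 2 ≤ (n + k + 1) ^ 4 * (n + k + 1) ^ 2 :=
      Nat.mul_le_mul_right _ h1
    rw [← pow_add] at h2
    refine le_trans ?_ h2
    nlinarith
  adj_le u _ v _ := by
    simp only [inputState]
    rw [if_neg (by omega), if_neg (by omega)]
    split_ifs <;> norm_num

/-- The hypotheses force `k ≥ 3`, hence `n ≤ 3 * k ≤ k ^ 2`. The resulting exponent `2 + 4 * k` is
at most `8 * k`. -/
theorem small_time_le (h2 : 2 * k ≤ n) (h3 : n + 2 < 3 * k) :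
    k * k * n ^ (2 * k) ≤ k ^ (8 * k) := by
  have hk : 3 ≤ k := by omega
  have h1 : n ≤ k ^ 2 := by nlinarith
  calc k * k * n ^ (2 * k) ≤ k ^ 2 * (k ^ 2) ^ (2 * k) := by
        rw [← pow_two]
        gcongr
    _ = k ^ (2 + 2 * (2 * k)) := by rw [← pow_mul, ← pow_add]
    _ ≤ k ^ (8 * k) := Nat.pow_le_pow_right (by omega) (by omega)

theorem lambdaProgram_runs (hG : G.Connected) (hk : 1 ≤ k) :
    Runs ((n + k + 1) ^ 6) lambdaProgram (inputState G k) fun t s =>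
      t ≤ 1100 * k ^ (8 * k) * n ^ 2 ∧ (IsLambdaConnected G k → s.reg 0 = 1) ∧
        (¬ IsLambdaConnected G k → s.reg 0 = 0) := by
  have hn : 0 < n := by
    obtain ⟨v⟩ := hG.nonempty
    exact v.pos
  have hI := isInput_inputState (G := G) hn hk
  have hB := hI.bound
  set B := (n + k + 1) ^ 6
  have hkpow : 1 ≤ k ^ (8 * k) := Nat.one_le_pow _ _ hk
  have hn2 : 1 ≤ n ^ 2 := Nat.one_le_pow _ _ hn
  have htime : ∀ {a b : ℕ}, a ≤ k ^ (8 * k) → b ≤ n ^ 2 →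
      1100 * (a * b) ≤ 1100 * k ^ (8 * k) * n ^ 2 := fun ha hb => by
    rw [mul_assoc]
    exact Nat.mul_le_mul_left _ (Nat.mul_le_mul ha hb)
  have hiff := isLambdaConnected_iff hG hk
  have hm0 : (inputState G k).mem 0 = n := rfl
  have hm1 : (inputState G k).mem 1 = k := rfl
  have hpre : Runs B (assign 1 (load 0) ;; assign 2 (load 1) ;; assign 3 (2 + reg 1 * reg 1))
      (inputState G k) fun t s => t ≤ 12 ∧ Base n k (inputState G k).mem 0 s ∧
        s.mem = (inputState G k).mem ∧ s.reg 4 = 0 ∧ s.reg 9 = 0 := by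
    refine Runs.of_wp ?_
    simp [Wp, maxCost, hm0, hm1]
    refine ⟨by omega, by omega, by omega, fun t ht => ⟨ht, ⟨?_, ?_, ?_, ?_, fun _ _ => rfl⟩,
      rfl, rfl⟩⟩
    all_goals simp [inputState]
  obtain ⟨t₁, s₁, hx₁, ht₁, H, hmem, h4, h9⟩ := hpre
  have hzero : ∀ a, 2 + n * n ≤ a → s₁.mem a = 0 := fun a ha => by
    rw [hmem, inputState_mem_of_ge ha]
  have hpost : Runs B (RamProgram.cond (2 * reg 2 - reg 1) skip
      (RamProgram.cond (3 * reg 2 - (reg 1 + 2)) smallProgram largeProgram)) s₁ fun t s =>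
      t + 12 ≤ 1100 * k ^ (8 * k) * n ^ 2 ∧ (IsLambdaConnected G k → s.reg 0 = 1) ∧
        (¬ IsLambdaConnected G k → s.reg 0 = 0) := by
    rw [hiff]
    have h11 := htime hkpow hn2
    refine Runs.cond ?_ (fun hlt => ?_) (fun h2k => ?_)
    · simp only [fits_sub, fits_mul, fits_ofNat, fits_reg, eval_mul, eval_reg, eval_ofNat, H.r₁,
        H.r₂]
      omega
    · simp only [eval_sub, eval_mul, eval_reg, eval_ofNat, H.r₁, H.r₂] at hlt
      refine ⟨1, s₁, .skip _, ?_, fun h => ?_, fun _ => H.r₀⟩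
      · simp only [cost_sub, cost_mul, cost_ofNat, cost_reg]
        omega
      · have := h.two_mul_le
        rw [Fintype.card_fin] at this
        omega
    simp only [eval_sub, eval_mul, eval_reg, eval_ofNat, H.r₁, H.r₂] at h2k
    refine Runs.cond ?_ (fun h3k => ?_) (fun h3k => ?_)
    · simp only [fits_sub, fits_mul, fits_add, fits_ofNat, fits_reg, eval_mul, eval_add, eval_reg,
        eval_ofNat, H.r₁, H.r₂]
      omega
    · simp only [eval_sub, eval_mul, eval_add, eval_reg, eval_ofNat, H.r₁, H.r₂] at h3k
      refine (small_runs hI H h4 hzero).mono ?_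
      rw [← exists_isGrowing_fin_iff hn memAdj_inputState,
        ← hasDisjointConnected_iff_exists_isGrowing hk]
      rintro t s ⟨ht, h⟩
      refine ⟨?_, h⟩
      have h5 := small_time_le (n := n) (k := k) (by omega) (by omega)
      have h6 : 1 ≤ k * k * n ^ (2 * k) :=
        Nat.mul_pos (Nat.mul_pos hk hk) (Nat.one_le_pow _ _ hn)
      have h7 := htime h5 hn2
      simp only [cost_sub, cost_mul, cost_add, cost_ofNat, cost_reg]
      rw [mul_assoc 600] at ht
      omega
    · simp only [eval_sub, eval_mul, eval_add, eval_reg, eval_ofNat, H.r₁, H.r₂] at h3k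
      refine (large_runs hI hG memAdj_inputState (by omega) (by omega) H h9 hzero).mono ?_
      rintro t s ⟨ht, h⟩
      refine ⟨?_, h⟩
      have h5 := htime hkpow (le_refl (n ^ 2))
      rw [pow_two] at hn2 h5 ⊢
      simp only [cost_sub, cost_mul, cost_add, cost_ofNat, cost_reg]
      omega
  obtain ⟨t₂, s₂, hx₂, ht₂, h₂⟩ := hpost
  cases hx₁ with
  | seq ha hx =>
    cases hx with
    | seq hb hc => exact ⟨_, _, .seq ha (.seq hb (.seq hc hx₂)), by omega, h₂⟩

end

theorem lambdaProgram_decides {T : ℕ → ℕ → ℝ}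
    (hT : ∀ n k : ℕ, 1 ≤ n → 1 ≤ k → 1100 * (k : ℝ) ^ (8 * k) * (n : ℝ) ^ 2 ≤ T n k) :
    DecidesInTime lambdaProgram EREC T := by
  refine ⟨6, fun n G k hG hk => ?_⟩
  obtain ⟨t, s, hx, ht, h⟩ := lambdaProgram_runs hG hk
  have hn : 1 ≤ n := by
    obtain ⟨v⟩ := hG.nonempty
    exact v.pos
  refine ⟨t, s, hx, le_trans ?_ (hT n k hn hk), h⟩
  exact_mod_cast ht

theorem computable_pow_self : Computable fun k : ℕ => 1100 * k ^ (8 * k) := by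
  have hpow : Primrec₂ fun a b : ℕ => a ^ b := Primrec₂.unpaired'.1 Nat.Primrec.pow
  exact (Primrec.nat_mul.comp (Primrec.const 1100)
    (hpow.comp Primrec.id (Primrec.nat_mul.comp (Primrec.const 8) Primrec.id))).to_comp

/-- After taking natural logarithms this says `8 ≤ 2000 * log 2` up to the factor `k * log k`, which
is nonnegative and vanishes for `k = 1`. -/
theorem pow_le_two_rpow {k : ℕ} (hk : 1 ≤ k) :
    (k : ℝ) ^ (8 * k) ≤ (2 : ℝ) ^ ((2000 : ℝ) * ((k : ℝ) * Real.log k)) := by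
  have hk' : (1 : ℝ) ≤ k := by exact_mod_cast hk
  have hlog : 0 ≤ (k : ℝ) * Real.log k := mul_nonneg (by linarith) (Real.log_nonneg hk')
  have h2 := Real.log_two_gt_d9
  rw [← Real.rpow_natCast, Real.rpow_def_of_pos (by linarith), Real.rpow_def_of_pos (by norm_num),
    Real.exp_le_exp]
  push_cast
  nlinarith

theorem theorem3p2 :
    IsFPT EREC ∧
      ∃ (P : RamProgram) (C : ℝ),
        DecidesInTime P EREC (fun n k =>
          C * (2 : ℝ) ^ (C * ((k : ℝ) * Real.log k)) * (n : ℝ) ^ 2 * Real.log ((n : ℝ) + 1)) := by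
  refine ⟨⟨lambdaProgram, _, 2, computable_pow_self, lambdaProgram_decides fun n k _ _ => ?_⟩,
    lambdaProgram, 2000, lambdaProgram_decides fun n k hn hk => ?_⟩
  · push_cast
    exact le_rfl
  · have hn' : (1 : ℝ) ≤ n := by exact_mod_cast hn
    -- The factor `log (n + 1)` is not needed for the algorithm; it is at least `log 2`, and `2000 *
    -- log 2 ≥ 1100` absorbs the constant.
    have hlog : Real.log 2 ≤ Real.log ((n : ℝ) + 1) :=
      Real.log_le_log (by norm_num) (by linarith)
    have h2 := Real.log_two_gt_d9
    have hp := pow_le_two_rpow hk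
    have hmul : (k : ℝ) ^ (8 * k) * (n : ℝ) ^ 2 ≤
        (2 : ℝ) ^ ((2000 : ℝ) * ((k : ℝ) * Real.log k)) * (n : ℝ) ^ 2 :=
      mul_le_mul_of_nonneg_right hp (sq_nonneg _)
    have h0 : 0 ≤ (k : ℝ) ^ (8 * k) * (n : ℝ) ^ 2 := by positivity
    calc 1100 * (k : ℝ) ^ (8 * k) * (n : ℝ) ^ 2
        = ((k : ℝ) ^ (8 * k) * (n : ℝ) ^ 2) * 1100 := by ring
      _ ≤ ((2 : ℝ) ^ ((2000 : ℝ) * ((k : ℝ) * Real.log k)) * (n : ℝ) ^ 2) *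
          (2000 * Real.log ((n : ℝ) + 1)) :=
        mul_le_mul hmul (by linarith) (by norm_num) (h0.trans hmul)
      _ = _ := by ring
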